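/- Let $d\ge 1$, and let $(X,\varphi,\mathbb Z^d)$, $(Y,\psi,\mathbb Z^d)$, $(Z,\alpha,\mathbb Z^d)$ be minimal free Cantor systems, i.e. free actions of $\mathbb Z^d$ by homeomorphisms on Cantor sets, all of whose orbits are dense. A map $\theta:X\to Z$ is an orbit injection from $(X,\varphi)$ to $(Z,\alpha)$ if it is continuous, open and injective, and if for all $x,y\in X$ one has $\varphi^w(x)=y$ for some $w\in\mathbb Z^d$ if and only if $\alpha^v(\theta(x))=\theta(y)$ for some $v\in\mathbb Z^d$. It is bounded if its cocycle $\eta:X\times\mathbb Z^d\to\mathbb Z^d$, defined by $\alpha^{\eta(x,w)}\theta(x)=\theta(\varphi^w x)$, is continuous. An orbit equivalence from $(X,\varphi)$ to $(Y,\psi)$ is a homeomorphism $X\to Y$ that maps orbits onto orbits. Put $G(\varphi)=C(X,\mathbb Z)/\langle f-f\circ\varphi^v : f\in C(X,\mathbb Z),\,v\in\mathbb Z^d\rangle$ with positive cone $G(\varphi)_+=\{[f]: f\ge 0\}$, and similarly for $\psi$ and $\alpha$. A bounded orbit injection $\theta:X\to Z$ induces a homomorphism $h_\theta:G(\varphi)\to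 G(\alpha)$ with $h_\theta[1_A]=[1_{\theta(A)}]$ for every clopen $A\subset X$. For $g,h\in G(\alpha)$ write $g<h$ if $h-g\in G(\alpha)_+$ and $g\ne h$, and let $$\mathrm{Inf}(G(\alpha))=\{g\in G(\alpha): ng<h \text{ for all } n\in\mathbb Z \text{ and all } h\in G(\alpha)_+\setminus\{0\}\}.$$ Theorem. Let $\theta_1$ and $\theta_2$ be bounded orbit injections from $(X,\varphi,\mathbb Z^d)$ and from $(Y,\psi,\mathbb Z^d)$, respectively, into $(Z,\alpha,\mathbb Z^d)$, and suppose that $h_{\theta_1}[1_X]-h_{\theta_2}[1_Y]\in \mathrm{Inf}(G(\alpha))$. Then for every $x_0\in X$ there is an orbit equivalence $\theta$ from $(X,\varphi,\mathbb Z^d)$ to $(Y,\psi,\mathbb Z^d)$ such that the cocycle function $\eta:X\times\mathbb Z^d\to\mathbb Z^d$ satisfying $$\varphi^w(x)=y\iff \psi^{\eta(x,w)}(\theta(x))=\theta(y)\qquad(x,y\in X,\ w\in\mathbb Z^d)$$ has the property that for every $w\in\mathbb Z^d$ the function $\eta(\cdot,w)$ is continuous on $X\setminus\{x_0,\varphi^{-w}x_0\}$.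 -/

import Mathlib

open Set Topology

/-- `X` is a Cantor set: a nonempty compact metrizable totally disconnected space
without isolated points. -/
class CantorSpace (X : Type*) [TopologicalSpace X] : Prop extends
    CompactSpace X, TopologicalSpace.MetrizableSpace X, TotallyDisconnectedSpace X,
    PerfectSpace X where
  nonempty : Nonempty X

/-- The action of `ℤ^d = (Fin d → ℤ)` on the space `X` is by homeomorphisms, is minimal
(every orbit is dense) and is free. The homeomorphism `φ^w` is `fun x ↦ w +ᵥ x`. -/
class MinimalFreeSystem (d : ℕ) (X : Type*) [TopologicalSpace X] [AddAction (Fin d → ℤ) X] :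
    Prop extends ContinuousConstVAdd (Fin d → ℤ) X, AddAction.IsMinimal (Fin d → ℤ) X where
  free : ∀ (w : Fin d → ℤ) (x : X), w +ᵥ x = x → w = 0

section OrbitMaps

variable (d : ℕ) {X Y : Type*} [TopologicalSpace X] [AddAction (Fin d → ℤ) X]
  [TopologicalSpace Y] [AddAction (Fin d → ℤ) Y]

/-- An orbit injection: a continuous open injection such that `x, y` lie in one orbit
iff `θ x, θ y` lie in one orbit. -/
structure IsOrbitInjection (θ : X → Y) : Prop where
  continuous : Continuous θ
  isOpenMap : IsOpenMap θ
  injective : Function.Injective θ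
  orbit_iff : ∀ x y : X, (∃ w : Fin d → ℤ, w +ᵥ x = y) ↔ (∃ v : Fin d → ℤ, v +ᵥ θ x = θ y)

/-- `η` is a cocycle for `θ`: `ψ^{η(x,w)} (θ x) = θ (φ^w x)`. If the action on `Y` is free, then
there is at most one such `η`. -/
def IsCocycle (θ : X → Y) (η : X × (Fin d → ℤ) → (Fin d → ℤ)) : Prop :=
  ∀ (x : X) (w : Fin d → ℤ), η (x, w) +ᵥ θ x = θ (w +ᵥ x)

/-- A bounded orbit injection: an orbit injection whose cocycle is continuous
(`ℤ^d` is discrete). -/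
structure IsBoundedOrbitInjection (θ : X → Y) : Prop extends IsOrbitInjection d θ where
  exists_continuous_cocycle : ∃ η : X × (Fin d → ℤ) → (Fin d → ℤ), IsCocycle d θ η ∧ Continuous η

/-- An orbit equivalence: a homeomorphism which maps orbits onto orbits. -/
def IsOrbitEquivalence (θ : X ≃ₜ Y) : Prop :=
  ∀ x : X, θ '' AddAction.orbit (Fin d → ℤ) x = AddAction.orbit (Fin d → ℤ) (θ x)

end OrbitMaps

section OrderedGroup

variable (d : ℕ) (X : Type*) [TopologicalSpace X] [AddAction (Fin d → ℤ) X]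

/-- The homeomorphism `φ^v`, as a continuous map. -/
def actMap [ContinuousConstVAdd (Fin d → ℤ) X] (v : Fin d → ℤ) : C(X, X) :=
  ⟨fun x => v +ᵥ x, continuous_const_vadd v⟩

/-- The subgroup `⟨f - f ∘ φ^v : f ∈ C(X,ℤ), v ∈ ℤ^d⟩` of `C(X,ℤ)`. -/
def coboundaries [ContinuousConstVAdd (Fin d → ℤ) X] : AddSubgroup C(X, ℤ) :=
  AddSubgroup.closure {g | ∃ (f : C(X, ℤ)) (v : Fin d → ℤ), g = f - f.comp (actMap d X v)}

/-- The group `G(φ) = C(X,ℤ) / ⟨f - f ∘ φ^v⟩`. -/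
abbrev DynCohomology [ContinuousConstVAdd (Fin d → ℤ) X] : Type _ :=
  C(X, ℤ) ⧸ coboundaries d X

/-- The class `[f]` in `G(φ)`. -/
def cohomClass [ContinuousConstVAdd (Fin d → ℤ) X] : C(X, ℤ) →+ DynCohomology d X :=
  QuotientAddGroup.mk' (coboundaries d X)

/-- The positive cone `G(φ)₊ = {[f] : f ≥ 0}`. -/
def positiveCone [ContinuousConstVAdd (Fin d → ℤ) X] : Set (DynCohomology d X) :=
  {g | ∃ f : C(X, ℤ), (∀ x, 0 ≤ f x) ∧ cohomClass d X f = g}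

/-- For a group `G` with positive cone `P`, the elements `g` such that `n g < h` for all
`n ∈ ℤ` and all `h ∈ P \ {0}`; here `a < b` means `b - a ∈ P` and `a ≠ b`. -/
def infinitesimals {G : Type*} [AddCommGroup G] (P : Set G) : Set G :=
  {g | ∀ (n : ℤ), ∀ h ∈ P \ {0}, h - n • g ∈ P ∧ n • g ≠ h}

end OrderedGroup

section InducedMap

variable (d : ℕ) {X Z : Type*} [TopologicalSpace X] [AddAction (Fin d → ℤ) X]
  [TopologicalSpace Z] [AddAction (Fin d → ℤ) Z] [CompactSpace X] [T2Space Z]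

theorem IsOrbitInjection.continuous_extend {θ : X → Z} (hθ : IsOrbitInjection d θ)
    (f : C(X, ℤ)) : Continuous (Function.extend θ f 0) := by
  have hemb : IsOpenEmbedding θ :=
    IsOpenEmbedding.of_continuous_injective_isOpenMap hθ.continuous hθ.injective hθ.isOpenMap
  have hclosed : IsClosed (range θ) := (isCompact_range hθ.continuous).isClosed
  rw [continuous_iff_continuousAt]
  intro z
  by_cases hz : z ∈ range θ
  · obtain ⟨x, rfl⟩ := hz
    rw [hemb.continuousAt_iff.symm]
    have : Function.extend θ f 0 ∘ θ = f := by
      ext x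
      exact hθ.injective.extend_apply _ _ _
    rw [this]
    exact f.continuous.continuousAt
  · have hev : Function.extend θ f 0 =ᶠ[𝓝 z] fun _ => (0 : ℤ) := by
      filter_upwards [hclosed.isOpen_compl.mem_nhds hz] with y hy
      rw [Function.extend_apply' _ _ _ (fun ⟨a, ha⟩ => hy ⟨a, ha⟩)]
      rfl
    exact continuousAt_const.congr hev.symm

/-- For an orbit injection `θ : X → Z` and `f ∈ C(X,ℤ)`, the function on `Z` which is
`f ∘ θ⁻¹` on the clopen set `θ(X)` and `0` elsewhere. It sends `1_A` to `1_{θ A}`. -/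
noncomputable def extendByZero {θ : X → Z} (hθ : IsOrbitInjection d θ) :
    C(X, ℤ) →+ C(Z, ℤ) where
  toFun f := ⟨Function.extend θ f 0, hθ.continuous_extend d f⟩
  map_zero' := by
    ext z
    by_cases hz : ∃ x, θ x = z
    · obtain ⟨x, rfl⟩ := hz
      simp [hθ.injective.extend_apply]
    · simp [Function.extend_apply' _ _ _ hz]
  map_add' f g := by
    ext z
    by_cases hz : ∃ x, θ x = z
    · obtain ⟨x, rfl⟩ := hz
      simp [hθ.injective.extend_apply]
    · simp [Function.extend_apply' _ _ _ hz]

theorem extendByZero_apply {θ : X → Z} (hθ : IsOrbitInjection d θ) (f : C(X, ℤ)) (x : X) :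
    extendByZero d hθ f (θ x) = f x :=
  hθ.injective.extend_apply _ _ _

theorem extendByZero_apply_of_notMem {θ : X → Z} (hθ : IsOrbitInjection d θ) (f : C(X, ℤ))
    {z : Z} (hz : z ∉ range θ) : extendByZero d hθ f z = 0 :=
  Function.extend_apply' (f := θ) f (0 : Z → ℤ) z hz

variable [ContinuousConstVAdd (Fin d → ℤ) X] [ContinuousConstVAdd (Fin d → ℤ) Z]

theorem coboundaries_le_comap {θ : X → Z} (hθ : IsBoundedOrbitInjection d θ) :
    coboundaries d X ≤ (coboundaries d Z).comap (extendByZero d hθ.toIsOrbitInjection) := by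
  classical
  obtain ⟨η, hη, hηc⟩ := hθ.exists_continuous_cocycle
  rw [coboundaries, AddSubgroup.closure_le]
  rintro _ ⟨f, v, rfl⟩
  have hcont : Continuous fun x => η (x, v) := hηc.comp (by fun_prop)
  have hfin : (range fun x => η (x, v)).Finite :=
    (isCompact_range hcont).finite_of_discrete
  have hclopen : ∀ u : Fin d → ℤ, IsClopen {x : X | η (-v +ᵥ x, v) = u} := fun u =>
    (isClopen_discrete {u}).preimage (hcont.comp (continuous_const_vadd (-v)))
  let F : (Fin d → ℤ) → C(X, ℤ) := fun u =>
    ⟨Set.indicator {x : X | η (-v +ᵥ x, v) = u} f, f.continuous.indicator (by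
      intro a ha
      rw [(hclopen u).frontier_eq] at ha
      exact absurd ha (notMem_empty a))⟩
  have hF : ∀ u x, F u x = if η (-v +ᵥ x, v) = u then f x else 0 := fun u x => by
    simp [F, Set.indicator_apply]
  have hsum : f = ∑ u ∈ hfin.toFinset, F u := by
    ext x
    rw [ContinuousMap.sum_apply]
    simp only [hF]
    rw [Finset.sum_ite_eq, if_pos (by simp)]
  have hterm : ∀ u, extendByZero d hθ.toIsOrbitInjection (F u - (F u).comp (actMap d X v)) ∈
      coboundaries d Z := by
    intro u
    have key : extendByZero d hθ.toIsOrbitInjection ((F u).comp (actMap d X v)) =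
        (extendByZero d hθ.toIsOrbitInjection (F u)).comp (actMap d Z u) := by
      ext z
      change _ = extendByZero d hθ.toIsOrbitInjection (F u) (u +ᵥ z)
      by_cases hz : ∃ x, θ x = z ∧ η (x, v) = u
      · obtain ⟨x, rfl, hx⟩ := hz
        have h := hη x v
        rw [hx] at h
        rw [extendByZero_apply, h, extendByZero_apply]
        rfl
      · have hl : extendByZero d hθ.toIsOrbitInjection ((F u).comp (actMap d X v)) z = 0 := by
          by_cases hr : z ∈ range θ
          · obtain ⟨x, rfl⟩ := hr
            rw [extendByZero_apply]
            change F u (v +ᵥ x) = 0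
            rw [hF, neg_vadd_vadd, if_neg (fun h => hz ⟨x, rfl, h⟩)]
          · exact extendByZero_apply_of_notMem d _ _ hr
        rw [hl]
        symm
        by_cases hr : u +ᵥ z ∈ range θ
        · obtain ⟨x, hx⟩ := hr
          rw [← hx, extendByZero_apply, hF, if_neg]
          intro h
          apply hz
          refine ⟨-v +ᵥ x, ?_, h⟩
          have h' := hη (-v +ᵥ x) v
          rw [h, vadd_neg_vadd, hx] at h'
          exact vadd_left_cancel u h'
        · exact extendByZero_apply_of_notMem d _ _ hr
    rw [map_sub, key]
    exact AddSubgroup.subset_closure ⟨_, u, rfl⟩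
  have hf : f - f.comp (actMap d X v) =
      ∑ u ∈ hfin.toFinset, (F u - (F u).comp (actMap d X v)) := by
    rw [Finset.sum_sub_distrib, ← hsum]
    congr 1
    ext x
    rw [ContinuousMap.sum_apply]
    conv_lhs => rw [hsum]
    change (∑ u ∈ hfin.toFinset, F u) (v +ᵥ x) = _
    rw [ContinuousMap.sum_apply]
    rfl
  change extendByZero d hθ.toIsOrbitInjection _ ∈ coboundaries d Z
  rw [hf, map_sum]
  exact AddSubgroup.sum_mem _ fun u _ => hterm u

/-- The homomorphism `h_θ : G(φ) → G(α)` induced by a bounded orbit injection `θ` from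
`(X, φ)` to `(Z, α)`; it is determined by `h_θ [1_A] = [1_{θ A}]` for clopen `A`. -/
noncomputable def inducedHom {θ : X → Z} (hθ : IsBoundedOrbitInjection d θ) :
    DynCohomology d X →+ DynCohomology d Z :=
  QuotientAddGroup.map (coboundaries d X) (coboundaries d Z)
    (extendByZero d hθ.toIsOrbitInjection) (coboundaries_le_comap d hθ)

theorem inducedHom_cohomClass {θ : X → Z} (hθ : IsBoundedOrbitInjection d θ) (f : C(X, ℤ)) :
    inducedHom d hθ (cohomClass d X f) =
      cohomClass d Z (extendByZero d hθ.toIsOrbitInjection f) :=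
  rfl

end InducedMap

/-! Inside `Z` the problem concerns two clopen sets, A = `range θ₁` and B = `range θ₂`. It suffices
to find a homeomorphism from A to B of the form z ↦ c(z) + z whose displacement c is locally
constant on A except at θ₁(x₀); conjugating by θ₁ and θ₂ gives the orbit equivalence, and continuity
of the two given cocycles controls the new one.

The hypothesis enters only through averages: an infinitesimal class is represented by a function
whose averages over large cubes of orbits tend to 0 uniformly
(`mem_nullFunctions_of_mem_infinitesimals`). So A and B have the same density, in this uniform
sense.

The main tool is clopen comparison (`exists_isMatching`): if P is strictly sparser than Q in every
translate of some cube, then P embeds in Q with continuous bounded displacement. Strict sparseness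
makes finite subsets of P expand in Q by a fixed factor. As ℤ^d has polynomial growth, Hall's
theorem then lets a partial matching absorb one more point by changes within a radius fixed in
advance, and such changes can be made simultaneously around the points of a separated clopen set.

Equal density is not strict, so a small clopen piece is left over on each side. A back-and-forth
argument (`exists_isDisplacementEquiv_step`) matches all but a small neighbourhood of x = θ₁(x₀)
with all but a small neighbourhood of a point y of B in the orbit of x, keeping the densities of the
leftovers equal. Iterating, the leftovers shrink to x and y, and x ↦ y completes the homeomorphism
(`exists_displacement_limit`). Continuity of c may fail only at x. -/

/-- The cube `[-n, n]^d` in `ℤ^d`. -/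
noncomputable def cube (d n : ℕ) : Finset (Fin d → ℤ) :=
  Fintype.piFinset fun _ => Finset.Icc (-(n : ℤ)) n

/-! ### Cubes in ℤ^d. -/

section Cube

variable {d : ℕ}

theorem mem_cube {n : ℕ} {v : Fin d → ℤ} : v ∈ cube d n ↔ ∀ i, |v i| ≤ n := by
  simp [cube, abs_le]

theorem card_cube (n : ℕ) : (cube d n).card = (2 * n + 1) ^ d := by
  simp only [cube, Fintype.card_piFinset, Int.card_Icc, Finset.prod_const, Finset.card_univ,
    Fintype.card_fin]
  congr 1
  omega

theorem card_cube_pos (n : ℕ) : 0 < (cube d n).card := by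
  rw [card_cube]; positivity

theorem zero_mem_cube (n : ℕ) : (0 : Fin d → ℤ) ∈ cube d n := by
  simp [mem_cube]

theorem cube_mono {m n : ℕ} (h : m ≤ n) : cube d m ⊆ cube d n := fun v hv => by
  rw [mem_cube] at hv ⊢
  exact fun i => (hv i).trans (by exact_mod_cast h)

theorem neg_mem_cube {n : ℕ} {v : Fin d → ℤ} (hv : v ∈ cube d n) : -v ∈ cube d n := by
  rw [mem_cube] at hv ⊢
  simpa using hv

theorem add_mem_cube {m n : ℕ} {v w : Fin d → ℤ} (hv : v ∈ cube d m) (hw : w ∈ cube d n) :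
    v + w ∈ cube d (m + n) := by
  rw [mem_cube] at hv hw ⊢
  intro i
  push_cast
  exact (abs_add_le _ _).trans (add_le_add (hv i) (hw i))

theorem sub_mem_cube {m n : ℕ} {v w : Fin d → ℤ} (hv : v ∈ cube d m) (hw : w ∈ cube d n) :
    v - w ∈ cube d (m + n) := by
  rw [sub_eq_add_neg]
  exact add_mem_cube hv (neg_mem_cube hw)

theorem exists_mem_cube (v : Fin d → ℤ) : ∃ n, v ∈ cube d n := by
  refine ⟨∑ i, (v i).natAbs, ?_⟩
  rw [mem_cube]
  intro i
  rw [Int.abs_eq_natAbs]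
  exact_mod_cast Finset.single_le_sum (f := fun i => (v i).natAbs) (fun _ _ => Nat.zero_le _)
    (Finset.mem_univ i)

theorem exists_cube_superset (s : Finset (Fin d → ℤ)) : ∃ n, s ⊆ cube d n := by
  choose n hn using exists_mem_cube (d := d)
  exact ⟨s.sup n, fun v hv => cube_mono (Finset.le_sup hv) (hn v)⟩

end Cube

/-! ### Matchings on a single orbit: expansion, growth and local augmentation. -/

section Matching

variable {d : ℕ}

open Classical in
open scoped Pointwise in
/-- If every translate of a cube has more points of `Q` than points of `P`, then finite subsets
of `P` expand in `Q`. -/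
theorem card_mul_le_card_nbhd {n : ℕ} {P Q : Set (Fin d → ℤ)}
    (h : ∀ t, ((cube d n).filter (fun f => f + t ∈ P)).card <
      ((cube d n).filter (fun f => f + t ∈ Q)).card)
    (S : Finset (Fin d → ℤ)) (hS : ∀ s ∈ S, s ∈ P) :
    ((cube d n).card + 1) * S.card ≤
      (cube d n).card * ((S + cube d (2 * n)).filter (fun q => q ∈ Q)).card := by
  set F := cube d n with hF
  set N := (S + cube d (2 * n)).filter (fun q => q ∈ Q) with hN
  -- Double counting over the windows t + F with t ∈ T, which include every window meeting S. Each
  -- window holds at least one more point of N than of S, so the total gain is at least |T| ≥ |S|.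
  set T := S + F with hT
  have hST : S.card ≤ T.card := Finset.card_le_card fun s hs =>
    Finset.mem_add.2 ⟨s, hs, 0, zero_mem_cube n, add_zero s⟩
  have h1 : ∑ t ∈ T, (S.filter (fun s => s - t ∈ F)).card = S.card * F.card := by
    have := Finset.sum_card_bipartiteAbove_eq_sum_card_bipartiteBelow (s := T) (t := S)
      (fun t s => s - t ∈ F)
    simp only [Finset.bipartiteAbove, Finset.bipartiteBelow] at this
    rw [this, Finset.sum_const_nat]
    intro s hs
    refine Finset.card_bij' (fun t _ => s - t) (fun f _ => s - f) ?_ ?_ ?_ ?_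
    · intro t ht
      exact (Finset.mem_filter.1 ht).2
    · intro f hf
      refine Finset.mem_filter.2 ⟨Finset.mem_add.2 ⟨s, hs, -f, neg_mem_cube hf, (sub_eq_add_neg s f).symm⟩, ?_⟩
      simpa using hf
    · intros; simp
    · intros; simp
  have h2 : ∑ t ∈ T, (N.filter (fun q => q - t ∈ F)).card ≤ N.card * F.card := by
    have := Finset.sum_card_bipartiteAbove_eq_sum_card_bipartiteBelow (s := T) (t := N)
      (fun t s => s - t ∈ F)
    simp only [Finset.bipartiteAbove, Finset.bipartiteBelow] at this
    rw [this]
    refine Finset.sum_le_card_nsmul _ _ _ fun q _ => ?_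
    refine Finset.card_le_card_of_injOn (fun t => q - t) ?_ ?_
    · intro t ht
      exact (Finset.mem_filter.1 ht).2
    · intro a _ b _ hab
      simpa using hab
  have h3 : ∀ t ∈ T, (S.filter (fun s => s - t ∈ F)).card + 1 ≤
      (N.filter (fun q => q - t ∈ F)).card := by
    intro t ht
    obtain ⟨s, hs, f, hf, rfl⟩ := Finset.mem_add.1 ht
    refine le_trans (Nat.succ_le_succ ?_) ((Nat.succ_le_of_lt (h (s + f))).trans ?_)
    · refine Finset.card_le_card_of_injOn (fun s' => s' - (s + f)) ?_ ?_
      · intro s' hs'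
        have hs' := Finset.mem_filter.1 hs'
        refine Finset.mem_filter.2 ⟨hs'.2, ?_⟩
        simpa using hS _ hs'.1
      · intro a _ b _ hab
        simpa using hab
    · refine Finset.card_le_card_of_injOn (fun g => g + (s + f)) ?_ ?_
      · intro g hg
        have hg := Finset.mem_filter.1 hg
        refine Finset.mem_filter.2 ⟨Finset.mem_filter.2 ⟨?_, hg.2⟩, by simpa using hg.1⟩
        refine Finset.mem_add.2 ⟨s, hs, g + f, ?_, add_left_comm s g f⟩
        rw [two_mul]
        exact add_mem_cube hg.1 hf
      · intro a _ b _ hab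
        simpa using hab
  have h4 := Finset.sum_le_sum h3
  rw [Finset.sum_add_distrib, h1, Finset.sum_const, smul_eq_mul, mul_one] at h4
  calc (F.card + 1) * S.card = S.card * F.card + S.card := by ring
    _ ≤ S.card * F.card + T.card := by omega
    _ ≤ _ := h4.trans h2
    _ = _ := mul_comm _ _

theorem exists_pow_mul_lt_pow (d f k : ℕ) :
    ∃ n, f ^ n * (2 * (2 * n * k) + 1) ^ d < (f + 1) ^ n := by
  have hr : |(f / (f + 1) : ℝ)| < 1 := by
    rw [abs_of_nonneg (by positivity), div_lt_one (by positivity)]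
    linarith
  have h := (tendsto_pow_const_mul_const_pow_of_abs_lt_one d hr).const_mul (((4 * k + 1) ^ d : ℝ))
  rw [mul_zero] at h
  obtain ⟨n, hn, hn1⟩ := ((h.eventually_lt_const one_pos).and
    (Filter.eventually_ge_atTop 1)).exists
  refine ⟨n, ?_⟩
  have h1 : (2 * (2 * n * k) + 1) ^ d ≤ ((4 * k + 1) * n) ^ d := by
    apply Nat.pow_le_pow_left
    nlinarith
  refine (Nat.mul_le_mul_left _ h1).trans_lt ?_
  rw [div_pow, ← mul_div_assoc, ← mul_div_assoc, div_lt_one (by positivity)] at hn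
  have : (f ^ n * ((4 * k + 1) * n) ^ d : ℝ) < (f + 1) ^ n := by
    rw [mul_pow]; linarith
  exact_mod_cast this

/-- By polynomial growth, a finite set containing the origin cannot grow by a fixed factor on
too many successive scales. -/
theorem exists_scale (d f k : ℕ) : ∃ n, ∀ S : Finset (Fin d → ℤ), 0 ∈ S → ∃ j < n,
    f * (S.filter (· ∈ cube d (2 * (j + 1) * k))).card ≤
      (f + 1) * (S.filter (· ∈ cube d (2 * j * k))).card := by
  obtain ⟨n, hn⟩ := exists_pow_mul_lt_pow d f k
  refine ⟨n, fun S hS => ?_⟩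
  by_contra! hcon
  -- If every scale failed, the counts would grow by more than the factor (f + 1)/f at each step, so
  -- exponentially, while a cube has only polynomially many points.
  have key : ∀ j ≤ n, (f + 1) ^ j ≤ f ^ j * (S.filter (· ∈ cube d (2 * j * k))).card := by
    intro j
    induction j with
    | zero =>
      intro _
      simp only [pow_zero, one_mul]
      exact Finset.card_pos.2 ⟨0, Finset.mem_filter.2 ⟨hS, zero_mem_cube _⟩⟩
    | succ j ih =>
      intro hj
      have h1 := ih (by omega)
      have h2 := hcon j (by omega)
      calc (f + 1) ^ (j + 1) = (f + 1) * (f + 1) ^ j := by ring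
        _ ≤ (f + 1) * (f ^ j * (S.filter (· ∈ cube d (2 * j * k))).card) :=
          Nat.mul_le_mul_left _ h1
        _ = f ^ j * ((f + 1) * (S.filter (· ∈ cube d (2 * j * k))).card) := by ring
        _ ≤ f ^ j * (f * (S.filter (· ∈ cube d (2 * (j + 1) * k))).card) :=
          Nat.mul_le_mul_left _ h2.le
        _ = _ := by ring
  have h1 := key n le_rfl
  have h2 : (S.filter (· ∈ cube d (2 * n * k))).card ≤ (2 * (2 * n * k) + 1) ^ d := by
    rw [← card_cube]
    exact Finset.card_le_card fun v hv => (Finset.mem_filter.1 hv).2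
  exact absurd (h1.trans (Nat.mul_le_mul_left _ h2)) (not_le.2 hn)

/-- `s` rematches the points of `D ∪ {0}` in the cube of radius `R` to points of `Q`, without
conflict with the values of the matching `m` of `D` outside that cube. -/
def IsRematching (R k : ℕ) (D Q : Set (Fin d → ℤ)) (m s : (Fin d → ℤ) → (Fin d → ℤ)) : Prop :=
  ∀ b ∈ cube d R, (b = 0 ∨ b ∈ D) → s b ∈ cube d k ∧ s b + b ∈ Q ∧
    (∀ b' ∈ cube d R, (b' = 0 ∨ b' ∈ D) → s b' + b' = s b + b → b' = b) ∧
    ∀ c ∈ cube d (R + 2 * k), c ∉ cube d R → c ∈ D → m c + c ≠ s b + b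

/-- Being a rematching depends only on the data in a cube of radius R + 2k. This finiteness is what
later makes the choice of rematching locally constant. -/
theorem IsRematching.congr {R k : ℕ} {D Q D' Q' : Set (Fin d → ℤ)}
    {m m' s : (Fin d → ℤ) → (Fin d → ℤ)} (h : IsRematching R k D Q m s)
    (hD : ∀ b ∈ cube d (R + 2 * k), b ∈ D' ↔ b ∈ D)
    (hQ : ∀ b ∈ cube d (R + 2 * k), b ∈ Q' ↔ b ∈ Q)
    (hm : ∀ b ∈ cube d (R + 2 * k), m' b = m b) : IsRematching R k D' Q' m' s := by
  have hsub : cube d R ⊆ cube d (R + 2 * k) := cube_mono (by omega)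
  intro b hb hbD
  rw [hD b (hsub hb)] at hbD
  obtain ⟨h1, h2, h3, h4⟩ := h b hb hbD
  refine ⟨h1, ?_, fun b' hb' hb'D => ?_, fun c hc hcR hcD => ?_⟩
  · rwa [hQ]
    exact cube_mono (by omega) (add_mem_cube h1 hb)
  · rw [hD b' (hsub hb')] at hb'D
    exact h3 b' hb' hb'D
  · rw [hm c hc]
    exact h4 c hc hcR ((hD c hc).1 hcD)

open Classical in
open scoped Pointwise in
/-- A partial matching can be extended to one more point by changing it in a cube around that
point only; the radius of the cube depends only on the expansion constant. -/
theorem exists_isRematching (d f k : ℕ) (hf : 0 < f) : ∃ R : ℕ, ∀ (P Q D : Set (Fin d → ℤ))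
    (m : (Fin d → ℤ) → (Fin d → ℤ)),
    (∀ S : Finset (Fin d → ℤ), (∀ s ∈ S, s ∈ P) →
      (f + 1) * S.card ≤ f * ((S + cube d k).filter (fun q => q ∈ Q)).card) →
    D ⊆ P → 0 ∈ P → (∀ b ∈ D, m b ∈ cube d k ∧ m b + b ∈ Q) →
    InjOn (fun b => m b + b) D → ∃ s, IsRematching R k D Q m s := by
  obtain ⟨n, hn⟩ := exists_scale d f k
  refine ⟨2 * n * k, fun P Q D m hexp hDP h0P hm hinj => ?_⟩
  set R := 2 * n * k with hR
  let ι := {b : Fin d → ℤ // b ∈ cube d R ∧ (b = 0 ∨ b ∈ D)}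
  -- Admissible targets of b: points of Q within k of b that are not already taken by a point of D
  -- outside the cube.
  let t : ι → Finset (Fin d → ℤ) := fun b =>
    ((cube d k).image (fun v => v + b.1)).filter
      (fun q => q ∈ Q ∧ ∀ c ∈ D, c ∉ cube d R → m c + c ≠ q)
  have ht : ∀ (b : ι) (q : Fin d → ℤ), q - b.1 ∈ cube d k → q ∈ Q →
      (∀ c ∈ D, c ∉ cube d R → m c + c ≠ q) → q ∈ t b := fun b q h1 h2 h3 =>
    Finset.mem_filter.2 ⟨Finset.mem_image.2 ⟨q - b.1, h1, sub_add_cancel _ _⟩, h2, h3⟩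
  have htm : ∀ b : ι, b.1 ∈ D → m b.1 + b.1 ∈ t b := fun b hb =>
    ht b _ (by simpa using (hm _ hb).1) (hm _ hb).2 fun c hc hcR hcb =>
      hcR (hinj hc hb hcb ▸ b.2.1)
  have hall : ∀ S : Finset ι, S.card ≤ (S.biUnion t).card := by
    intro S
    set S' := S.map (Function.Embedding.subtype _) with hS'
    have hcard : S'.card = S.card := Finset.card_map _
    have hmem : ∀ b, b ∈ S' ↔ ∃ c ∈ S, c.1 = b := by
      intro b
      rw [hS', Finset.mem_map]
      rfl
    have hval : ∀ b ∈ S', b ∈ cube d R ∧ (b = 0 ∨ b ∈ D) := by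
      intro b hb
      obtain ⟨c, _, rfl⟩ := (hmem b).1 hb
      exact c.2
    have hmU : ∀ b ∈ S', b ≠ 0 → m b + b ∈ S.biUnion t := by
      intro b hb hb0
      obtain ⟨c, hc, rfl⟩ := (hmem b).1 hb
      exact Finset.mem_biUnion.2 ⟨c, hc, htm c (c.2.2.resolve_left hb0)⟩
    have hinj' : ∀ T : Finset (Fin d → ℤ), (∀ b ∈ T, b ∈ S' ∧ b ≠ 0) →
        (T.image (fun b => m b + b)).card = T.card := fun T hT =>
      Finset.card_image_of_injOn (hinj.mono fun b hb =>
        (hval b (hT b hb).1).2.resolve_left (hT b hb).2)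
    -- Hall's condition. If 0 ∉ S', the old matching m already provides enough targets. If 0 ∈ S',
    -- at a good scale j the expansion of the inner part `Sj` supplies at least as many targets `N1`
    -- as S' has points in the next larger cube; the points beyond it keep their images `N2`. A
    -- buffer of width 2k keeps the two families disjoint.
    by_cases h0 : (0 : Fin d → ℤ) ∈ S'
    · obtain ⟨j, hjn, hj⟩ := hn S' h0
      set Sj := S'.filter (· ∈ cube d (2 * j * k)) with hSj
      set T := S'.filter (fun b => ¬ b ∈ cube d (2 * (j + 1) * k)) with hT
      have hle : 2 * (j + 1) * k ≤ R := Nat.mul_le_mul_right _ (by omega)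
      have hcardT : (S'.filter (· ∈ cube d (2 * (j + 1) * k))).card + T.card = S'.card :=
        Finset.card_filter_add_card_filter_not _
      set N1 := (Sj + cube d k).filter (fun q => q ∈ Q) with hN1
      set N2 := T.image (fun b => m b + b) with hN2
      have hTS : ∀ b ∈ T, b ∈ S' ∧ b ≠ 0 := fun b hb =>
        ⟨(Finset.mem_filter.1 hb).1, fun h => (Finset.mem_filter.1 hb).2 (h ▸ zero_mem_cube _)⟩
      have hN1c : ∀ q ∈ N1, q ∈ cube d (2 * j * k + k) := by
        intro q hq
        obtain ⟨b, hb, v, hv, rfl⟩ := Finset.mem_add.1 (Finset.mem_filter.1 hq).1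
        exact add_mem_cube (Finset.mem_filter.1 hb).2 hv
      have hsmall : ∀ c ∈ D, m c + c ∈ cube d (2 * j * k + k) →
          c ∈ cube d (2 * (j + 1) * k) := by
        intro c hc hcq
        have := sub_mem_cube hcq (hm c hc).1
        rw [add_sub_cancel_left] at this
        exact cube_mono (by ring_nf; omega) this
      have hsub1 : N1 ⊆ S.biUnion t := by
        intro q hq
        have hqc := hN1c q hq
        obtain ⟨hq1, hqQ⟩ := Finset.mem_filter.1 hq
        obtain ⟨b, hb, v, hv, rfl⟩ := Finset.mem_add.1 hq1
        obtain ⟨c, hc, rfl⟩ := (hmem b).1 (Finset.mem_filter.1 hb).1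
        refine Finset.mem_biUnion.2 ⟨c, hc, ht c _ (by simpa using hv) hqQ ?_⟩
        intro c' hc' hc'R heq
        exact hc'R (cube_mono hle (hsmall c' hc' (heq ▸ hqc)))
      have hsub2 : N2 ⊆ S.biUnion t := by
        intro q hq
        obtain ⟨b, hb, rfl⟩ := Finset.mem_image.1 hq
        exact hmU b (hTS b hb).1 (hTS b hb).2
      have hdisj : Disjoint N1 N2 := by
        rw [Finset.disjoint_left]
        intro q hq1 hq2
        obtain ⟨b, hb, rfl⟩ := Finset.mem_image.1 hq2
        have hbD : b ∈ D := (hval b (hTS b hb).1).2.resolve_left (hTS b hb).2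
        exact (Finset.mem_filter.1 hb).2 (hsmall b hbD (hN1c _ hq1))
      have h1 : N1.card + N2.card ≤ (S.biUnion t).card := by
        rw [← Finset.card_union_of_disjoint hdisj]
        exact Finset.card_le_card (Finset.union_subset hsub1 hsub2)
      have h2 : N2.card = T.card := hinj' T hTS
      have h3 := hexp Sj fun s hs =>
        (hval s (Finset.mem_filter.1 hs).1).2.elim (fun h => h ▸ h0P) fun h => hDP h
      refine le_trans ?_ h1
      rw [← hcard, ← hcardT, h2]
      have h4 := hj.trans h3
      exact Nat.add_le_add_right (Nat.le_of_mul_le_mul_left h4 hf) _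
    · have hne : ∀ b ∈ S', b ∈ S' ∧ b ≠ 0 := fun b hb => ⟨hb, fun h => h0 (h ▸ hb)⟩
      rw [← hcard, ← hinj' S' hne]
      apply Finset.card_le_card
      intro q hq
      obtain ⟨b, hb, rfl⟩ := Finset.mem_image.1 hq
      exact hmU b hb (hne b hb).2
  obtain ⟨g, hg, hgt⟩ := (Finset.all_card_le_biUnion_card_iff_exists_injective t).1 hall
  refine ⟨fun b => if h : b ∈ cube d R ∧ (b = 0 ∨ b ∈ D) then g ⟨b, h⟩ - b else 0, ?_⟩
  intro b hb hbD
  have hgb := Finset.mem_filter.1 (hgt ⟨b, hb, hbD⟩)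
  obtain ⟨v, hv, hvb⟩ := Finset.mem_image.1 hgb.1
  simp only [dif_pos (show b ∈ cube d R ∧ (b = 0 ∨ b ∈ D) from ⟨hb, hbD⟩), sub_add_cancel]
  refine ⟨?_, hgb.2.1, ?_, fun c _ hcR hcD => hgb.2.2 c hcD hcR⟩
  · rw [← hvb]
    simpa using hv
  · intro b' hb' hb'D heq
    simp only [dif_pos (show b' ∈ cube d R ∧ (b' = 0 ∨ b' ∈ D) from ⟨hb', hb'D⟩),
      sub_add_cancel] at heq
    exact congrArg Subtype.val (hg heq)

end Matching

/-! ### Clopen comparison in the minimal system. -/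

section Comparison

variable {d : ℕ} {Z : Type*} [TopologicalSpace Z] [AddAction (Fin d → ℤ) Z]

theorem vadd_left_cancel_of_free [MinimalFreeSystem d Z] {b c : Fin d → ℤ} {z : Z}
    (h : b +ᵥ z = c +ᵥ z) : b = c := by
  have h1 : (-c + b) +ᵥ z = z := by rw [add_vadd, h, neg_vadd_vadd]
  have h2 := MinimalFreeSystem.free _ _ h1
  rw [neg_add_eq_zero] at h2
  exact h2.symm

theorem IsClopen.eventually_vadd_mem_iff [ContinuousConstVAdd (Fin d → ℤ) Z] {D : Set Z}
    (hD : IsClopen D) (b : Fin d → ℤ) (z : Z) : ∀ᶠ z' in 𝓝 z, (b +ᵥ z' ∈ D ↔ b +ᵥ z ∈ D) := by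
  have hc : ContinuousAt (fun z' : Z => b +ᵥ z') z := (continuous_const_vadd b).continuousAt
  by_cases h : b +ᵥ z ∈ D
  · filter_upwards [hc (hD.isOpen.mem_nhds h)] with z' hz'
    exact iff_of_true hz' h
  · filter_upwards [hc (hD.compl.isOpen.mem_nhds h)] with z' hz'
    exact iff_of_false hz' h

theorem Continuous.eventually_eq_of_discrete {W A : Type*} [TopologicalSpace W]
    [TopologicalSpace A] [DiscreteTopology A] {m : W → A} (hm : Continuous m) (z : W) :
    ∀ᶠ z' in 𝓝 z, m z' = m z :=
  hm.continuousAt.eventually (p := fun a => a = m z) (by simp)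

theorem continuous_of_eventually_eq {W A : Type*} [TopologicalSpace W]
    [TopologicalSpace A] {m : W → A} (h : ∀ z, ∀ᶠ z' in 𝓝 z, m z' = m z) :
    Continuous m :=
  continuous_iff_continuousAt.2 fun z =>
    (continuousAt_const (y := m z)).congr ((h z).mono fun _ hz => hz.symm)

/-- `z ↦ m z +ᵥ z` maps `D` injectively into `Q`, and `m` is continuous with values of size at
most `k` on `D`. -/
structure IsMatching (k : ℕ) (D Q : Set Z) (m : Z → (Fin d → ℤ)) : Prop where
  continuous : Continuous m
  mem_cube : ∀ z ∈ D, m z ∈ cube d k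
  mapsTo : ∀ z ∈ D, m z +ᵥ z ∈ Q
  injOn : InjOn (fun z => m z +ᵥ z) D

variable [MinimalFreeSystem d Z]

/-- Simultaneous local rematching around the points of a separated clopen set `U`. -/
theorem IsMatching.exists_union {R k : ℕ} {D Q U : Set Z} {m : Z → (Fin d → ℤ)}
    (hm : IsMatching k D Q m) (hD : IsClopen D) (hQ : IsClopen Q) (hU : IsClopen U)
    (hsep : ∀ v ∈ cube d (2 * (R + k)), v ≠ 0 → ∀ x ∈ U, v +ᵥ x ∉ U)
    (hloc : ∀ z ∈ U, ∃ s, IsRematching R k {b | b +ᵥ z ∈ D} {b | b +ᵥ z ∈ Q}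
      (fun b => m (b +ᵥ z)) s) : ∃ m' : Z → (Fin d → ℤ), IsMatching k (D ∪ U) Q m' := by
  classical
  let r : Z → ((Fin d → ℤ) → (Fin d → ℤ)) → Prop := fun z =>
    IsRematching R k {b | b +ᵥ z ∈ D} {b | b +ᵥ z ∈ Q} (fun b => m (b +ᵥ z))
  -- The choice operator is applied to the predicate `r z` alone, so points with the same predicate
  -- receive the same rematching; hence `sel` is locally constant.
  let sel : Z → (Fin d → ℤ) → (Fin d → ℤ) := fun z => Classical.epsilon (r z)
  have hsel : ∀ z ∈ U, r z (sel z) := fun z hz => Classical.epsilon_spec (hloc z hz)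
  have hsel_ev : ∀ z, ∀ᶠ z' in 𝓝 z, sel z' = sel z := by
    intro z
    have hall : ∀ᶠ z' in 𝓝 z, ∀ b ∈ cube d (R + 2 * k), (b +ᵥ z' ∈ D ↔ b +ᵥ z ∈ D) ∧
        (b +ᵥ z' ∈ Q ↔ b +ᵥ z ∈ Q) ∧ m (b +ᵥ z') = m (b +ᵥ z) :=
      (Filter.eventually_all_finset _).2 fun b _ =>
        (hD.eventually_vadd_mem_iff b z).and ((hQ.eventually_vadd_mem_iff b z).and
          ((hm.continuous.comp (continuous_const_vadd b)).eventually_eq_of_discrete z))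
    filter_upwards [hall] with z' hz'
    have : r z' = r z := by
      funext s
      refine propext ⟨fun h => h.congr ?_ ?_ ?_, fun h => h.congr ?_ ?_ ?_⟩
      · exact fun b hb => (hz' b hb).1.symm
      · exact fun b hb => (hz' b hb).2.1.symm
      · exact fun b hb => (hz' b hb).2.2.symm
      · exact fun b hb => (hz' b hb).1
      · exact fun b hb => (hz' b hb).2.1
      · exact fun b hb => (hz' b hb).2.2
    simp only [sel, this]
  let p : Z → (Fin d → ℤ) → Prop := fun y b => b ∈ cube d R ∧ -b +ᵥ y ∈ U
  -- Position of y relative to the nearby point of U, when one exists; separation makes it unique.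
  let β : Z → (Fin d → ℤ) := fun y => Classical.epsilon (p y)
  let m' : Z → (Fin d → ℤ) := fun y =>
    if ∃ b, p y b then sel (-β y +ᵥ y) (β y) else m y
  have hzero : ∀ v ∈ cube d (2 * (R + k)), ∀ x ∈ U, v +ᵥ x ∈ U → v = 0 := by
    intro v hv x hx hvx
    by_contra h0
    exact hsep v hv h0 x hx hvx
  have hnear : ∀ b ∈ cube d R, ∀ z ∈ U, m' (b +ᵥ z) = sel z b := by
    intro b hb z hz
    have hex : ∃ b', p (b +ᵥ z) b' := ⟨b, hb, by rwa [neg_vadd_vadd]⟩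
    have hβ : p (b +ᵥ z) (β (b +ᵥ z)) := Classical.epsilon_spec hex
    have hβb : β (b +ᵥ z) = b := by
      obtain ⟨h1, h2⟩ := hβ
      rw [← add_vadd] at h2
      have := hzero _ (cube_mono (by omega) (add_mem_cube (neg_mem_cube h1) hb)) z hz h2
      rw [neg_add_eq_zero] at this
      exact this
    simp only [m', if_pos hex, hβb, neg_vadd_vadd]
  have hfar : ∀ y, (∀ b ∈ cube d R, -b +ᵥ y ∉ U) → m' y = m y := by
    intro y hy
    simp only [m']
    rw [if_neg]
    rintro ⟨b, hb, hbU⟩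
    exact hy b hb hbU
  have hdich : ∀ y ∈ D ∪ U, (∃ z ∈ U, ∃ b ∈ cube d R, y = b +ᵥ z ∧ (b = 0 ∨ b +ᵥ z ∈ D) ∧
      m' y = sel z b) ∨ (y ∈ D ∧ (∀ b ∈ cube d R, -b +ᵥ y ∉ U) ∧ m' y = m y) := by
    intro y hy
    by_cases h : ∃ b ∈ cube d R, -b +ᵥ y ∈ U
    · obtain ⟨b, hb, hbU⟩ := h
      left
      refine ⟨_, hbU, b, hb, (vadd_neg_vadd b y).symm, ?_, ?_⟩
      · rw [vadd_neg_vadd]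
        refine hy.symm.imp (fun hyU => ?_) id
        exact hzero b (cube_mono (by omega) hb) _ hbU (by rwa [vadd_neg_vadd])
      · conv_lhs => rw [← vadd_neg_vadd b y]
        exact hnear b hb _ hbU
    · push Not at h
      right
      refine ⟨hy.resolve_right fun hyU => h 0 (zero_mem_cube R) ?_, h, hfar y h⟩
      simpa using hyU
  have hclash : ∀ z ∈ U, ∀ b ∈ cube d R, (b = 0 ∨ b +ᵥ z ∈ D) → ∀ y ∈ D,
      (∀ b ∈ cube d R, -b +ᵥ y ∉ U) → m y +ᵥ y ≠ sel z b +ᵥ b +ᵥ z := by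
    intro z hz b hb hbD y hy hyU heq
    obtain ⟨h1, -, -, h4⟩ := hsel z hz b hb hbD
    have hyc : y = (-m y + (sel z b + b)) +ᵥ z := by
      rw [add_vadd, add_vadd, ← heq, neg_vadd_vadd]
    -- c is the position of y relative to z. Two displacements of size at most k and one of size at
    -- most R place it in the cube of radius R + 2k, where the last clause of `IsRematching`
    -- excludes the clash.
    set c := -m y + (sel z b + b) with hc
    have hcc : c ∈ cube d (R + 2 * k) :=
      cube_mono (by omega) (add_mem_cube (neg_mem_cube (hm.mem_cube y hy)) (add_mem_cube h1 hb))
    refine h4 c hcc (fun hcR => hyU c hcR ?_) (by simpa [← hyc] using hy) ?_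
    · rw [hyc, neg_vadd_vadd]
      exact hz
    · simp only [← hyc]
      rw [hc]
      abel
  refine ⟨m', continuous_of_eventually_eq fun y => ?_, fun y hy => ?_, fun y hy => ?_, ?_⟩
  · have hp : ∀ᶠ y' in 𝓝 y, ∀ b ∈ cube d R, (-b +ᵥ y' ∈ U ↔ -b +ᵥ y ∈ U) :=
      (Filter.eventually_all_finset _).2 fun b _ => hU.eventually_vadd_mem_iff (-b) y
    have hs : ∀ᶠ y' in 𝓝 y, sel (-β y +ᵥ y') = sel (-β y +ᵥ y) :=
      (continuous_const_vadd (-β y)).continuousAt.eventually (hsel_ev (-β y +ᵥ y))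
    filter_upwards [hp, hs, hm.continuous.eventually_eq_of_discrete y] with y' hp' hs' hm'
    have hpp : p y' = p y := by
      funext b
      exact propext (and_congr_right fun hb => hp' b hb)
    have hββ : β y' = β y := by simp only [β, hpp]
    simp only [m', hpp, hββ, hs', hm']
  · obtain ⟨z, hz, b, hb, -, hbD, h⟩ | ⟨hyD, -, h⟩ := hdich y hy
    · rw [h]
      exact (hsel z hz b hb hbD).1
    · rw [h]
      exact hm.mem_cube y hyD
  · obtain ⟨z, hz, b, hb, rfl, hbD, h⟩ | ⟨hyD, -, h⟩ := hdich y hy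
    · rw [h, ← add_vadd]
      exact (hsel z hz b hb hbD).2.1
    · rw [h]
      exact hm.mapsTo y hyD
  · intro y hy y' hy' heq
    simp only at heq
    obtain ⟨z, hz, b, hb, rfl, hbD, h⟩ | ⟨hyD, hyU, h⟩ := hdich y hy <;>
      obtain ⟨z', hz', b', hb', rfl, hbD', h'⟩ | ⟨hyD', hyU', h'⟩ := hdich y' hy' <;>
      rw [h, h'] at heq
    · obtain ⟨h1, -, h3, -⟩ := hsel z hz b hb hbD
      obtain ⟨h1', -, -, -⟩ := hsel z' hz' b' hb' hbD'
      have hzz : (-(sel z' b' + b') + (sel z b + b)) +ᵥ z = z' := by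
        rw [add_vadd, add_vadd, heq, ← add_vadd (sel z' b'), neg_vadd_vadd]
      have hv := hzero _ (cube_mono (by omega) (add_mem_cube (neg_mem_cube (add_mem_cube h1' hb'))
        (add_mem_cube h1 hb))) z hz (by rwa [hzz])
      rw [hv, zero_vadd] at hzz
      subst hzz
      rw [← add_vadd, ← add_vadd] at heq
      rw [h3 b' hb' hbD' (vadd_left_cancel_of_free heq).symm]
    · exact absurd heq.symm (hclash z hz b hb hbD y' hyD' hyU')
    · exact absurd heq (hclash z' hz' b' hb' hbD' y hyD hyU)
    · exact hm.injOn hyD hyD' heq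

variable [CantorSpace Z]

/-- By freeness the finitely many nonzero v in the cube move z off itself, so they move a small
enough neighbourhood of z off itself. -/
theorem exists_isClopen_separated (k : ℕ) (z : Z) {W : Set Z} (hW : W ∈ 𝓝 z) :
    ∃ C : Set Z, IsClopen C ∧ z ∈ C ∧ C ⊆ W ∧ ∀ v ∈ cube d k, v ≠ 0 → ∀ x ∈ C, v +ᵥ x ∉ C := by
  have h1 : ∀ v ∈ cube d k, ∃ V ∈ 𝓝 z, v ≠ 0 → ∀ x ∈ V, v +ᵥ x ∉ V := by
    intro v _
    by_cases hv : v = 0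
    · exact ⟨univ, Filter.univ_mem, fun h => absurd hv h⟩
    · have hne : z ≠ v +ᵥ z := fun h => hv (MinimalFreeSystem.free v z h.symm)
      obtain ⟨A, B, hA, hB, hzA, hzB, hAB⟩ := t2_separation hne
      refine ⟨A ∩ (fun x => v +ᵥ x) ⁻¹' B, Filter.inter_mem (hA.mem_nhds hzA)
        ((continuous_const_vadd v).continuousAt (hB.mem_nhds hzB)), fun _ x hx hx' => ?_⟩
      exact disjoint_left.1 hAB hx'.1 hx.2
  choose! V hV hVd using h1
  have h2 : W ∩ ⋂ v ∈ cube d k, V v ∈ 𝓝 z :=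
    Filter.inter_mem hW ((Filter.biInter_finset_mem _).2 hV)
  obtain ⟨O, hOs, hO, hzO⟩ := mem_nhds_iff.1 h2
  obtain ⟨C, hC, hzC, hCO⟩ := compact_exists_isClopen_in_isOpen hO hzO
  refine ⟨C, hC, hzC, fun x hx => (hOs (hCO hx)).1, fun v hv hv0 x hx hvx => ?_⟩
  exact hVd v hv hv0 x (mem_iInter₂.1 (hOs (hCO hx)).2 v hv)
    (mem_iInter₂.1 (hOs (hCO hvx)).2 v hv)

open Classical in
/-- Clopen comparison: if all translates of some cube have strictly more visits to `Q` than
to `P`, then `P` embeds in `Q` by a map with continuous displacement. -/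
theorem exists_isMatching {n : ℕ} {P Q : Set Z} (hP : IsClopen P) (hQ : IsClopen Q)
    (h : ∀ z : Z, ((cube d n).filter (fun b => b +ᵥ z ∈ P)).card <
      ((cube d n).filter (fun b => b +ᵥ z ∈ Q)).card) :
    ∃ k, ∃ m : Z → (Fin d → ℤ), IsMatching k P Q m := by
  obtain ⟨R, hR⟩ := exists_isRematching d (cube d n).card (2 * n) (card_cube_pos n)
  refine ⟨2 * n, ?_⟩
  -- R depends only on n and d, not on the matching built so far. Hence one finite cover by
  -- separated sets serves the whole induction and the bound 2n on displacements never grows.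
  choose C hC hzC _ hCsep using fun z : Z =>
    exists_isClopen_separated (d := d) (2 * (R + 2 * n)) z Filter.univ_mem
  obtain ⟨t, ht⟩ := CompactSpace.elim_nhds_subcover C fun z => (hC z).isOpen.mem_nhds (hzC z)
  have key : ∀ t : Finset Z, ∃ m : Z → (Fin d → ℤ),
      IsMatching (2 * n) (P ∩ ⋃ x ∈ t, C x) Q m := by
    intro t
    induction t using Finset.induction_on with
    | empty => exact ⟨fun _ => 0, continuous_const, by simp, by simp, by simp⟩
    | insert x t hx ih =>
      obtain ⟨m, hm⟩ := ih
      set D := P ∩ ⋃ x ∈ t, C x with hD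
      have hDc : IsClopen D := hP.inter (t.finite_toSet.isClopen_biUnion fun x _ => hC x)
      have hunion : P ∩ ⋃ y ∈ insert x t, C y = D ∪ (C x ∩ P) \ D := by
        rw [Finset.set_biUnion_insert, union_sdiff_self, hD, inter_union_distrib_left,
          inter_comm P (C x), union_comm]
      rw [hunion]
      refine hm.exists_union hDc hQ (((hC x).inter hP).diff hDc)
        (fun v hv hv0 y hy hvy => hCsep x v hv hv0 y hy.1.1 hvy.1.1) fun z hz => ?_
      refine hR {b | b +ᵥ z ∈ P} _ _ _ (fun S hS => card_mul_le_card_nbhd (fun t => ?_) S hS)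
        (fun b hb => hb.1) (by simpa using hz.1.2) (fun b hb => ⟨hm.mem_cube _ hb, ?_⟩) ?_
      · simpa only [mem_ofPred_eq, add_vadd] using h (t +ᵥ z)
      · simpa only [mem_ofPred_eq, add_vadd] using hm.mapsTo _ hb
      · intro b hb c hc hbc
        have := hm.injOn hb hc (by simpa only [add_vadd] using congrArg (· +ᵥ z) hbc)
        exact vadd_left_cancel_of_free this
  obtain ⟨m, hm⟩ := key t
  rw [ht, top_eq_univ, inter_univ] at hm
  exact ⟨m, hm⟩

end Comparison

/-! ### Functions of uniformly vanishing mean; infinitesimals have null representatives. -/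

section NullFunctions

theorem eventually_card_cube_sub_le (d k : ℕ) {ε : ℝ} (hε : 0 < ε) :
    ∀ᶠ N in Filter.atTop,
      ((cube d (N + k)).card - (cube d N).card : ℝ) ≤ ε * (cube d N).card := by
  have h0 : Filter.Tendsto (fun N : ℕ => (2 * k : ℝ) / (2 * N + 1)) Filter.atTop (𝓝 0) := by
    apply Filter.Tendsto.div_atTop tendsto_const_nhds
    exact Filter.tendsto_atTop_add_const_right _ _
      (tendsto_natCast_atTop_atTop.const_mul_atTop two_pos)
  have h1 : Filter.Tendsto (fun N : ℕ => (1 + (2 * k : ℝ) / (2 * N + 1)) ^ d) Filter.atTop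
      (𝓝 1) := by
    simpa using (h0.const_add 1).pow d
  filter_upwards [h1.eventually_le_const (show (1 : ℝ) < 1 + ε by linarith)] with N hN
  have h2 : ((cube d (N + k)).card : ℝ) =
      (1 + (2 * k : ℝ) / (2 * N + 1)) ^ d * (cube d N).card := by
    rw [card_cube, card_cube]
    push_cast
    rw [← mul_pow]
    congr 1
    field_simp
    ring
  have h3 : (0 : ℝ) ≤ (cube d N).card := by positivity
  rw [h2]
  nlinarith

/-- The functions whose averages over large cubes of the orbits tend to `0` uniformly. -/
def nullFunctions (d : ℕ) (Z : Type*) [AddAction (Fin d → ℤ) Z] : Submodule ℝ (Z → ℝ) where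
  carrier := {F | ∀ ε > 0, ∀ᶠ N in Filter.atTop, ∀ z,
    |∑ b ∈ cube d N, F (b +ᵥ z)| ≤ ε * (cube d N).card}
  zero_mem' := fun ε hε => Filter.Eventually.of_forall fun N z => by
    simp only [Pi.zero_apply, Finset.sum_const_zero, abs_zero]
    positivity
  add_mem' := fun {F G} hF hG ε hε => by
    filter_upwards [hF (ε / 2) (half_pos hε), hG (ε / 2) (half_pos hε)] with N h1 h2 z
    simp only [Pi.add_apply, Finset.sum_add_distrib]
    calc _ ≤ _ := abs_add_le _ _
      _ ≤ _ := add_le_add (h1 z) (h2 z)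
      _ = _ := by ring
  smul_mem' := fun c F hF ε hε => by
    have hc : 0 < |c| + 1 := by positivity
    filter_upwards [hF (ε / (|c| + 1)) (by positivity)] with N h1 z
    simp only [Pi.smul_apply, smul_eq_mul, ← Finset.mul_sum, abs_mul]
    calc |c| * |∑ b ∈ cube d N, F (b +ᵥ z)|
        ≤ (|c| + 1) * (ε / (|c| + 1) * (cube d N).card) :=
          mul_le_mul (by linarith) (h1 z) (abs_nonneg _) hc.le
      _ = ε * (cube d N).card := by field_simp

variable {d : ℕ} {Z : Type*} [AddAction (Fin d → ℤ) Z]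

theorem abs_sum_cube_sub_le {F : Z → ℝ} {c : ℝ} (hF : ∀ z, |F z| ≤ c) {k : ℕ} {v : Fin d → ℤ}
    (hv : v ∈ cube d k) (N : ℕ) (z : Z) :
    |∑ b ∈ cube d (N + k), F (b +ᵥ z) - ∑ b ∈ cube d N, F (v +ᵥ b +ᵥ z)| ≤
      c * ((cube d (N + k)).card - (cube d N).card) := by
  classical
  set T := (cube d N).map (addLeftEmbedding v) with hT
  have h1 : ∑ b ∈ cube d N, F (v +ᵥ b +ᵥ z) = ∑ b ∈ T, F (b +ᵥ z) := by
    rw [hT, Finset.sum_map]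
    simp [add_vadd]
  have hsub : T ⊆ cube d (N + k) := by
    intro b hb
    obtain ⟨b', hb', rfl⟩ := Finset.mem_map.1 hb
    rw [add_comm N]
    exact add_mem_cube hv hb'
  have hcard : ((cube d (N + k) \ T).card : ℝ) = (cube d (N + k)).card - (cube d N).card := by
    rw [Finset.cast_card_sdiff hsub, hT, Finset.card_map]
  rw [h1, ← Finset.sum_sdiff hsub, add_sub_cancel_right, ← hcard, mul_comm, ← nsmul_eq_mul]
  exact (Finset.abs_sum_le_sum_abs _ _).trans (Finset.sum_le_card_nsmul _ _ _ fun b _ => hF _)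

/-- The sums over the cube of radius N and over its translate by v both differ from the sum over the
cube of radius N + k by a boundary term, which is negligible relative to the volume. -/
theorem sub_comp_mem_nullFunctions {F : Z → ℝ} {c : ℝ} (hF : ∀ z, |F z| ≤ c)
    (v : Fin d → ℤ) : (fun z => F z - F (v +ᵥ z)) ∈ nullFunctions d Z := by
  intro ε hε
  obtain ⟨k, hk⟩ := exists_mem_cube v
  have hc : 0 < 2 * (|c| + 1) := by positivity
  filter_upwards [eventually_card_cube_sub_le d k (div_pos hε hc)] with N hN z
  have h1 := abs_sum_cube_sub_le hF hk N z
  have h2 := abs_sum_cube_sub_le hF (zero_mem_cube (d := d) k) N z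
  simp only [zero_vadd] at h2
  rw [Finset.sum_sub_distrib]
  set δ : ℝ := (cube d (N + k)).card - (cube d N).card with hδ
  have hδ0 : 0 ≤ δ := sub_nonneg.2 (by
    exact_mod_cast Finset.card_le_card (cube_mono (Nat.le_add_right N k)))
  have h3 : c * δ ≤ (|c| + 1) * δ :=
    mul_le_mul_of_nonneg_right ((le_abs_self c).trans (by linarith)) hδ0
  have h4 : 2 * (|c| + 1) * δ ≤ ε * (cube d N).card := by
    calc 2 * (|c| + 1) * δ ≤ 2 * (|c| + 1) * (ε / (2 * (|c| + 1)) * (cube d N).card) :=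
          mul_le_mul_of_nonneg_left hN hc.le
      _ = ε * (cube d N).card := by field_simp
  rw [abs_le] at h1 h2 ⊢
  constructor <;> linarith [h1.1, h1.2, h2.1, h2.2]

/-- Averaging over a fixed cube changes a bounded function by a null one, so pointwise bounds on
local averages become density bounds. -/
theorem card_mul_sub_sum_mem_nullFunctions {F : Z → ℝ} {c : ℝ} (hF : ∀ z, |F z| ≤ c) (k : ℕ) :
    (fun z => (cube d k).card * F z - ∑ v ∈ cube d k, F (v +ᵥ z)) ∈ nullFunctions d Z := by
  have : (fun z => (cube d k).card * F z - ∑ v ∈ cube d k, F (v +ᵥ z)) =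
      ∑ v ∈ cube d k, fun z => F z - F (v +ᵥ z) := by
    ext z
    simp [Finset.sum_apply, Finset.sum_sub_distrib]
  rw [this]
  exact Submodule.sum_mem _ fun v _ => sub_comp_mem_nullFunctions hF v

variable [TopologicalSpace Z]

theorem ContinuousMap.exists_abs_intCast_le [CompactSpace Z] (f : C(Z, ℤ)) :
    ∃ c : ℝ, ∀ z, |(f z : ℝ)| ≤ c := by
  have h : Continuous fun z => (f z : ℝ) := continuous_of_discreteTopology.comp f.continuous
  obtain ⟨c, hc⟩ := isCompact_univ.exists_bound_of_continuousOn h.continuousOn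
  exact ⟨c, fun z => hc z (mem_univ z)⟩

theorem mem_nullFunctions_of_mem_coboundaries [CompactSpace Z] [ContinuousConstVAdd (Fin d → ℤ) Z]
    {f : C(Z, ℤ)} (hf : f ∈ coboundaries d Z) : (fun z => (f z : ℝ)) ∈ nullFunctions d Z := by
  induction hf using AddSubgroup.closure_induction with
  | mem f hf =>
    obtain ⟨g, v, rfl⟩ := hf
    obtain ⟨c, hc⟩ := g.exists_abs_intCast_le
    simpa [actMap] using sub_comp_mem_nullFunctions hc v
  | zero =>
    simp only [ContinuousMap.zero_apply, Int.cast_zero]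
    exact (nullFunctions d Z).zero_mem
  | add f g _ _ hf hg =>
    simp only [ContinuousMap.add_apply, Int.cast_add]
    exact (nullFunctions d Z).add_mem hf hg
  | neg f _ hf =>
    simp only [ContinuousMap.neg_apply, Int.cast_neg]
    exact (nullFunctions d Z).neg_mem hf

theorem cohomClass_one_ne_zero [CompactSpace Z] [Nonempty Z]
    [ContinuousConstVAdd (Fin d → ℤ) Z] : cohomClass d Z 1 ≠ 0 := by
  intro h
  have h1 := mem_nullFunctions_of_mem_coboundaries ((QuotientAddGroup.eq_zero_iff _).1 h)
  obtain ⟨N, hN⟩ := (h1 (1 / 2) (by norm_num)).exists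
  have h2 := hN (Classical.arbitrary Z)
  have h3 : (0 : ℝ) < (cube d N).card := by exact_mod_cast card_cube_pos N
  simp only [ContinuousMap.one_apply, Int.cast_one, Finset.sum_const, nsmul_eq_mul, mul_one] at h2
  rw [abs_of_pos h3] at h2
  linarith

theorem mem_nullFunctions_of_mem_infinitesimals [CompactSpace Z] [Nonempty Z]
    [ContinuousConstVAdd (Fin d → ℤ) Z] {f : C(Z, ℤ)}
    (hf : cohomClass d Z f ∈ infinitesimals (positiveCone d Z)) :
    (fun z => (f z : ℝ)) ∈ nullFunctions d Z := by
  -- Test the infinitesimal against h = [1]: since 1 - n f is cohomologous to some g ≥ 0, the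
  -- averages of n f are at most 1 + o(1), hence eventually at most 2. Taking n and -n large in
  -- absolute value then makes the averages of f small.
  have key : ∀ n : ℤ, ∀ᶠ N in Filter.atTop, ∀ z,
      n * ∑ b ∈ cube d N, (f (b +ᵥ z) : ℝ) ≤ 2 * (cube d N).card := by
    intro n
    obtain ⟨⟨g, hg, hgc⟩, -⟩ := hf n (cohomClass d Z 1)
      ⟨⟨1, fun _ => zero_le_one, rfl⟩, cohomClass_one_ne_zero⟩
    rw [← map_zsmul, ← map_sub, ← sub_eq_zero, ← map_sub] at hgc
    have h1 := mem_nullFunctions_of_mem_coboundaries ((QuotientAddGroup.eq_zero_iff _).1 hgc)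
    filter_upwards [h1 1 one_pos] with N hN z
    have h2 := (abs_le.1 (hN z)).2
    have h3 : ∀ z, (((g - (1 - n • f)) z : ℤ) : ℝ) = g z - 1 + n * f z := by
      intro z
      simp only [ContinuousMap.sub_apply, ContinuousMap.one_apply, ContinuousMap.smul_apply,
        smul_eq_mul]
      push_cast
      ring
    simp only [h3, Finset.sum_add_distrib, Finset.sum_sub_distrib, ← Finset.mul_sum,
      Finset.sum_const, nsmul_eq_mul, mul_one] at h2
    have h4 : (0 : ℝ) ≤ ∑ b ∈ cube d N, (g (b +ᵥ z) : ℝ) :=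
      Finset.sum_nonneg fun b _ => by exact_mod_cast hg _
    linarith
  intro ε hε
  obtain ⟨n, hn⟩ := exists_nat_gt (2 / ε)
  have hn0 : (0 : ℝ) < n := (by positivity : 0 < 2 / ε).trans hn
  rw [div_lt_iff₀ hε] at hn
  filter_upwards [key n, key (-n)] with N h1 h2 z
  have h1 := h1 z
  have h2 := h2 z
  push_cast at h1 h2
  have h3 : (0 : ℝ) ≤ (cube d N).card := by positivity
  have h4 : (2 : ℝ) * (cube d N).card ≤ n * (ε * (cube d N).card) := by nlinarith
  rw [abs_le]
  constructor
  · refine le_of_mul_le_mul_left ?_ hn0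
    linarith
  · refine le_of_mul_le_mul_left ?_ hn0
    linarith

end NullFunctions

/-! ### Clopen sets equivalent by continuous displacement, and the back-and-forth step. -/

section ClopenEquiv

variable {d : ℕ} {Z : Type*} [TopologicalSpace Z] [AddAction (Fin d → ℤ) Z]

/-- `z ↦ m z +ᵥ z` is a bijection from `P` to `Q`, and `m` is continuous. -/
structure IsDisplacementEquiv (P Q : Set Z) (m : Z → (Fin d → ℤ)) : Prop where
  continuous : Continuous m
  bijOn : BijOn (fun z => m z +ᵥ z) P Q

variable {P Q : Set Z} {m : Z → (Fin d → ℤ)}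

theorem IsDisplacementEquiv.exists_union {P' Q' : Set Z} {m' : Z → (Fin d → ℤ)}
    (h : IsDisplacementEquiv P Q m) (h' : IsDisplacementEquiv P' Q' m') (hP : IsClopen P)
    (hPP : Disjoint P P') (hQQ : Disjoint Q Q') :
    ∃ m'' : Z → (Fin d → ℤ), IsDisplacementEquiv (P ∪ P') (Q ∪ Q') m'' := by
  classical
  let m'' : Z → (Fin d → ℤ) := fun z => if z ∈ P then m z else m' z
  have h1 : ∀ z ∈ P, m'' z = m z := fun z hz => if_pos hz
  have h2 : ∀ z ∉ P, m'' z = m' z := fun z hz => if_neg hz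
  have e1 : EqOn (fun z => m z +ᵥ z) (fun z => m'' z +ᵥ z) P := fun z hz => by
    simp only [h1 z hz]
  have e2 : EqOn (fun z => m' z +ᵥ z) (fun z => m'' z +ᵥ z) P' := fun z hz => by
    simp only [h2 z (disjoint_right.1 hPP hz)]
  have b1 := h.bijOn.congr e1
  have b2 := h'.bijOn.congr e2
  refine ⟨m'', continuous_of_eventually_eq fun z => ?_, b1.union b2 ?_⟩
  · by_cases hz : z ∈ P
    · filter_upwards [hP.isOpen.mem_nhds hz, h.continuous.eventually_eq_of_discrete z]
        with z' hz' hm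
      rw [h1 z' hz', h1 z hz, hm]
    · filter_upwards [hP.compl.isOpen.mem_nhds hz, h'.continuous.eventually_eq_of_discrete z]
        with z' hz' hm
      rw [h2 z' hz', h2 z hz, hm]
  · rw [injOn_union hPP]
    exact ⟨b1.injOn, b2.injOn, fun z hz z' hz' =>
      hQQ.ne_of_mem (b1.mapsTo hz) (b2.mapsTo hz')⟩

section

variable [ContinuousConstVAdd (Fin d → ℤ) Z]

theorem continuousAt_displacement {m : Z → (Fin d → ℤ)} {z : Z}
    (hm : ∀ᶠ z' in 𝓝 z, m z' = m z) : ContinuousAt (fun z => m z +ᵥ z) z :=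
  (continuous_const_vadd (m z)).continuousAt.congr (hm.mono fun z' hz' => by simp only [hz'])

theorem IsDisplacementEquiv.eventually_neg_vadd (h : IsDisplacementEquiv P Q m)
    (hP : IsOpen P) {z : Z} (hz : z ∈ P) :
    ∀ᶠ y in 𝓝 (m z +ᵥ z), -m z +ᵥ y ∈ P ∧ m (-m z +ᵥ y) = m z := by
  have hc : Filter.Tendsto (fun y : Z => -m z +ᵥ y) (𝓝 (m z +ᵥ z)) (𝓝 z) := by
    simpa using (continuous_const_vadd (-m z)).tendsto (m z +ᵥ z)
  exact (hc.eventually (hP.mem_nhds hz)).and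
    (hc.eventually (h.continuous.eventually_eq_of_discrete z))

theorem IsDisplacementEquiv.isClopen [CompactSpace Z] [T2Space Z]
    (h : IsDisplacementEquiv P Q m) (hP : IsClopen P) : IsClopen Q := by
  constructor
  · rw [← h.bijOn.image_eq]
    exact (hP.isClosed.isCompact.image (continuous_iff_continuousAt.2 fun z =>
      continuousAt_displacement (h.continuous.eventually_eq_of_discrete z))).isClosed
  · rw [isOpen_iff_mem_nhds]
    intro y hy
    obtain ⟨z, hz, rfl⟩ := h.bijOn.surjOn hy
    filter_upwards [h.eventually_neg_vadd hP.isOpen hz] with y hy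
    have := h.bijOn.mapsTo hy.1
    simpa only [hy.2, vadd_neg_vadd] using this

theorem IsDisplacementEquiv.exists_symm (h : IsDisplacementEquiv P Q m) (hP : IsClopen P)
    (hQ : IsClopen Q) : ∃ m' : Z → (Fin d → ℤ), IsDisplacementEquiv Q P m' := by
  classical
  rcases isEmpty_or_nonempty Z with hZ | hZ
  · exact ⟨m, h.continuous, by
      rw [Set.eq_empty_of_isEmpty P, Set.eq_empty_of_isEmpty Q]; exact bijOn_empty _⟩
  let g := Function.invFunOn (fun z => m z +ᵥ z) P
  have hg : ∀ z ∈ P, g (m z +ᵥ z) = z := fun z hz => h.bijOn.injOn.leftInvOn_invFunOn hz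
  let m' : Z → (Fin d → ℤ) := fun y => if y ∈ Q then -m (g y) else 0
  have hm' : ∀ z ∈ P, m' (m z +ᵥ z) = -m z := fun z hz => by
    simp only [m', if_pos (h.bijOn.mapsTo hz), hg z hz]
  refine ⟨m', continuous_of_eventually_eq fun y => ?_, ?_, ?_, ?_⟩
  · by_cases hy : y ∈ Q
    · obtain ⟨z, hz, rfl⟩ := h.bijOn.surjOn hy
      filter_upwards [h.eventually_neg_vadd hP.isOpen hz] with y hy
      have := hm' _ hy.1
      rw [hy.2, vadd_neg_vadd] at this
      rw [this]
      exact (hm' z hz).symm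
    · filter_upwards [hQ.compl.isOpen.mem_nhds hy] with y' hy'
      simp only [m', if_neg hy, if_neg hy']
  · intro y hy
    obtain ⟨z, hz, rfl⟩ := h.bijOn.surjOn hy
    simp only [hm' z hz, neg_vadd_vadd]
    exact hz
  · intro y hy y' hy' heq
    obtain ⟨z, hz, rfl⟩ := h.bijOn.surjOn hy
    obtain ⟨z', hz', rfl⟩ := h.bijOn.surjOn hy'
    simp only [hm' z hz, hm' z' hz', neg_vadd_vadd] at heq
    rw [heq]
  · intro z hz
    exact ⟨_, h.bijOn.mapsTo hz, by simp only [hm' z hz, neg_vadd_vadd]⟩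

end

theorem abs_indicator_one_le {W : Type*} (A : Set W) (z : W) :
    |A.indicator (1 : W → ℝ) z| ≤ 1 := by
  by_cases hz : z ∈ A <;> simp [hz]

/-- By compactness m takes finitely many values. Cutting P into its level sets writes the difference
as a finite sum of terms F - F ∘ φ^{-v}. -/
theorem IsDisplacementEquiv.sub_mem_nullFunctions [CompactSpace Z] {P Q : Set Z}
    {m : Z → (Fin d → ℤ)} (h : IsDisplacementEquiv P Q m) :
    P.indicator 1 - Q.indicator 1 ∈ nullFunctions d Z := by
  classical
  have hfin : (range m).Finite := (isCompact_range h.continuous).finite_of_discrete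
  let S : (Fin d → ℤ) → Set Z := fun v => {z | z ∈ P ∧ m z = v}
  have heq : P.indicator 1 - Q.indicator 1 = ∑ v ∈ hfin.toFinset,
      fun z => (S v).indicator (1 : Z → ℝ) z - (S v).indicator 1 (-v +ᵥ z) := by
    ext z
    simp only [Pi.sub_apply, Finset.sum_apply, Finset.sum_sub_distrib]
    congr 1
    · by_cases hz : z ∈ P
      · rw [Finset.sum_eq_single_of_mem (m z) (by simp)]
        · simp [S, hz]
        · intro v _ hv
          exact indicator_of_notMem (fun h => hv h.2.symm) _
      · rw [indicator_of_notMem hz, Finset.sum_eq_zero]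
        intro v _
        exact indicator_of_notMem (fun h => hz h.1) _
    · by_cases hz : z ∈ Q
      · obtain ⟨y, hy, rfl⟩ := h.bijOn.surjOn hz
        rw [Finset.sum_eq_single_of_mem (m y) (by simp)]
        · simp only at hz
          simp [S, hy, hz]
        · intro v _ hv
          refine indicator_of_notMem (fun hS => hv ?_) _
          have hyy := h.bijOn.injOn hS.1 hy (by simp only [hS.2, vadd_neg_vadd])
          rw [← hS.2, hyy]
      · rw [indicator_of_notMem hz, Finset.sum_eq_zero]
        intro v _
        refine indicator_of_notMem (fun hS => hz ?_) _
        have := h.bijOn.mapsTo hS.1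
        simpa only [hS.2, vadd_neg_vadd] using this
  rw [heq]
  exact Submodule.sum_mem _ fun v _ => sub_comp_mem_nullFunctions (abs_indicator_one_le _) (-v)

theorem IsDisplacementEquiv.sub_mem_nullFunctions_of_diff [CompactSpace Z] {A A' B B' : Set Z}
    {m : Z → (Fin d → ℤ)} (h : IsDisplacementEquiv (A \ A') (B \ B') m) (hA : A' ⊆ A)
    (hB : B' ⊆ B) (hAB : A.indicator 1 - B.indicator 1 ∈ nullFunctions d Z) :
    A'.indicator 1 - B'.indicator 1 ∈ nullFunctions d Z := by
  have h1 := (nullFunctions d Z).sub_mem hAB h.sub_mem_nullFunctions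
  rw [indicator_sdiff hA, indicator_sdiff hB] at h1
  convert h1 using 1
  abel

variable [CantorSpace Z] [MinimalFreeSystem d Z]

/-- Minimality and compactness: finitely many translates of A cover the space, so visits to A have
bounded gaps. -/
theorem exists_forall_exists_vadd_mem {A : Set Z} (hA : IsOpen A) (hne : A.Nonempty) :
    ∃ k, ∀ z : Z, ∃ b ∈ cube d k, b +ᵥ z ∈ A := by
  obtain ⟨I, hI⟩ := isCompact_univ.exists_finite_cover_vadd (Fin d → ℤ) hA hne
  obtain ⟨k, hk⟩ := exists_cube_superset I
  refine ⟨k, fun z => ?_⟩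
  obtain ⟨g, hg, hz⟩ := mem_iUnion₂.1 (hI (mem_univ z))
  exact ⟨-g, neg_mem_cube (hk hg), mem_vadd_set_iff_neg_vadd_mem.1 hz⟩

theorem exists_isMatching_of_sum_lt {n : ℕ} {P Q : Set Z} (hP : IsClopen P) (hQ : IsClopen Q)
    (h : ∀ z : Z, ∑ v ∈ cube d n, P.indicator (1 : Z → ℝ) (v +ᵥ z) <
      ∑ v ∈ cube d n, Q.indicator (1 : Z → ℝ) (v +ᵥ z)) :
    ∃ k, ∃ m : Z → (Fin d → ℤ), IsMatching k P Q m := by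
  classical
  refine exists_isMatching (n := n) hP hQ fun z => ?_
  have hcard : ∀ C : Set Z, (((cube d n).filter (fun b => b +ᵥ z ∈ C)).card : ℝ) =
      ∑ v ∈ cube d n, C.indicator (1 : Z → ℝ) (v +ᵥ z) := by
    intro C
    rw [Finset.card_filter]
    push_cast
    exact Finset.sum_congr rfl fun v _ => by simp [indicator_apply]
  rw [← Nat.cast_lt (α := ℝ), hcard, hcard]
  exact h z

/-- If `1_A - 1_B` is null, then the complement in `A` of a nonempty clopen set can be mapped
to the complement in `B` of some clopen neighbourhood of a given point. -/
theorem exists_isDisplacementEquiv_diff (hd : 0 < d) {A A' B : Set Z} (hA : IsClopen A)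
    (hA' : IsClopen A') (hB : IsClopen B) (hAA : A' ⊆ A) (hne : A'.Nonempty) {y : Z} (hy : y ∈ B)
    (hAB : A.indicator 1 - B.indicator 1 ∈ nullFunctions d Z) :
    ∃ B' ⊆ B, IsClopen B' ∧ y ∈ B' ∧ ∃ m : Z → (Fin d → ℤ),
      IsDisplacementEquiv (A \ A') (B \ B') m := by
  classical
  obtain ⟨k, hk⟩ := exists_forall_exists_vadd_mem (d := d) hA'.isOpen hne
  -- A' meets every cube of radius k, so its density is at least 1/a; B₀ is so separated that it
  -- meets each cube of radius l at most once, so its density is at most 1/b. As d > 0, a < b, and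
  -- removing A' and B₀ leaves A strictly sparser than B.
  set l := k + 1 with hl
  obtain ⟨B₀, hB₀, hyB₀, hBB, hsep⟩ :=
    exists_isClopen_separated (d := d) (l + l) y (hB.isOpen.mem_nhds hy)
  set a : ℝ := ((cube d k).card : ℝ) with ha
  set b : ℝ := ((cube d l).card : ℝ) with hb
  have hab : a + 1 ≤ b := by
    have : (cube d k).card < (cube d l).card := by
      rw [card_cube, card_cube]
      exact Nat.pow_lt_pow_left (by omega) hd.ne'
    rw [ha, hb]
    exact_mod_cast this
  have ha0 : 0 < a := by
    rw [ha]
    exact_mod_cast card_cube_pos k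
  have hb0 : 0 < b := by linarith
  have hsumA : ∀ z : Z, 1 ≤ ∑ v ∈ cube d k, A'.indicator (1 : Z → ℝ) (v +ᵥ z) := by
    intro z
    obtain ⟨v, hv, hvz⟩ := hk z
    calc (1 : ℝ) = A'.indicator (1 : Z → ℝ) (v +ᵥ z) := by simp [hvz]
      _ ≤ _ := Finset.single_le_sum (f := fun v => A'.indicator (1 : Z → ℝ) (v +ᵥ z))
        (fun _ _ => indicator_nonneg (fun _ _ => zero_le_one) _) hv
  have hsumB : ∀ z : Z, ∑ v ∈ cube d l, B₀.indicator (1 : Z → ℝ) (v +ᵥ z) ≤ 1 := by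
    intro z
    by_cases h : ∃ v ∈ cube d l, v +ᵥ z ∈ B₀
    · obtain ⟨v, hv, hvz⟩ := h
      rw [Finset.sum_eq_single_of_mem v hv]
      · simp [hvz]
      · intro w hw hwv
        refine indicator_of_notMem (fun hwz => ?_) _
        refine hsep (w - v) (sub_mem_cube hw hv) (sub_ne_zero.2 hwv) _ hvz ?_
        rwa [← add_vadd, sub_add_cancel]
    · push Not at h
      rw [Finset.sum_eq_zero fun v hv => indicator_of_notMem (h v hv) _]
      exact zero_le_one
  have hnull := (nullFunctions d Z).sub_mem ((nullFunctions d Z).sub_mem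
    ((nullFunctions d Z).smul_mem b
      (card_mul_sub_sum_mem_nullFunctions (d := d) (abs_indicator_one_le A') k))
    ((nullFunctions d Z).smul_mem a
      (card_mul_sub_sum_mem_nullFunctions (d := d) (abs_indicator_one_le B₀) l)))
    ((nullFunctions d Z).smul_mem (a * b) hAB)
  obtain ⟨N, hN⟩ := (hnull (1 / 2) (by norm_num)).exists
  have hcount : ∀ z : Z, ∑ v ∈ cube d N, (A \ A').indicator (1 : Z → ℝ) (v +ᵥ z) <
      ∑ v ∈ cube d N, (B \ B₀).indicator (1 : Z → ℝ) (v +ᵥ z) := by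
    intro z
    rw [← sub_pos, ← Finset.sum_sub_distrib]
    have h1 := (abs_le.1 (hN z)).1
    -- After cancellation the right side is b ∑ 1_{A'} - a ∑ 1_{B₀}, with sums over the cubes of
    -- radius k and l, which is at least b - a ≥ 1. The null part costs at most half of this on
    -- average.
    have h2 : ∀ v ∈ cube d N, (1 : ℝ) ≤
        a * b * ((B \ B₀).indicator 1 (v +ᵥ z) - (A \ A').indicator 1 (v +ᵥ z)) -
        (b • (fun z => (cube d k).card * A'.indicator (1 : Z → ℝ) z -
            ∑ v ∈ cube d k, A'.indicator (1 : Z → ℝ) (v +ᵥ z)) -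
          a • (fun z => (cube d l).card * B₀.indicator (1 : Z → ℝ) z -
            ∑ v ∈ cube d l, B₀.indicator (1 : Z → ℝ) (v +ᵥ z)) -
          (a * b) • (A.indicator 1 - B.indicator 1 : Z → ℝ)) (v +ᵥ z) := by
      intro v _
      rw [indicator_sdiff hAA, indicator_sdiff hBB]
      simp only [Pi.sub_apply, Pi.smul_apply, smul_eq_mul, ← ha, ← hb]
      have h3 := mul_le_mul_of_nonneg_left (hsumA (v +ᵥ z)) hb0.le
      have h4 := mul_le_mul_of_nonneg_left (hsumB (v +ᵥ z)) ha0.le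
      linarith
    have h3 := Finset.sum_le_sum h2
    rw [Finset.sum_sub_distrib, ← Finset.mul_sum, Finset.sum_const, nsmul_eq_mul, mul_one] at h3
    have h4 : (0 : ℝ) < (cube d N).card := by exact_mod_cast card_cube_pos N
    refine pos_of_mul_pos_right (a := a * b) ?_ (by positivity)
    linarith
  obtain ⟨k', m, hm⟩ := exists_isMatching_of_sum_lt (hA.diff hA') (hB.diff hB₀) hcount
  set E := (fun z => m z +ᵥ z) '' (A \ A') with hE
  have hmE : IsDisplacementEquiv (A \ A') E m := ⟨hm.continuous, hm.injOn.bijOn_image⟩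
  have hEB : E ⊆ B \ B₀ := by
    rintro _ ⟨z, hz, rfl⟩
    exact hm.mapsTo z hz
  -- B' is whatever the image E misses. It contains B₀ and hence y, but need not be small.
  refine ⟨B \ E, sdiff_subset, hB.diff (hmE.isClopen (hA.diff hA')),
    ⟨hy, fun h => (hEB h).2 hyB₀⟩, m, ?_⟩
  rwa [sdiff_sdiff_cancel_left (hEB.trans sdiff_subset)]

/-- `exists_isDisplacementEquiv_diff` prescribes the leftover on one side only. Applying it from A
to B makes the first leftover small; applying it again from B to A inside the leftovers makes the
second small and only shrinks the first. -/
theorem exists_isDisplacementEquiv_step (hd : 0 < d) {A B V W : Set Z} {x y : Z}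
    (hA : IsClopen A) (hB : IsClopen B) (hx : x ∈ A) (hy : y ∈ B)
    (hAB : A.indicator 1 - B.indicator 1 ∈ nullFunctions d Z) (hV : V ∈ 𝓝 x) (hW : W ∈ 𝓝 y) :
    ∃ A' B' : Set Z, IsClopen A' ∧ IsClopen B' ∧ x ∈ A' ∧ y ∈ B' ∧ A' ⊆ A ∩ V ∧ B' ⊆ B ∩ W ∧
      A'.indicator 1 - B'.indicator 1 ∈ nullFunctions d Z ∧
      ∃ m : Z → (Fin d → ℤ), IsDisplacementEquiv (A \ A') (B \ B') m := by
  have hsmall : ∀ {C U : Set Z} {z : Z}, IsClopen C → z ∈ C → U ∈ 𝓝 z →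
      ∃ C', IsClopen C' ∧ z ∈ C' ∧ C' ⊆ C ∩ U := by
    intro C U z hC hz hU
    obtain ⟨O, hOs, hO, hzO⟩ := mem_nhds_iff.1 (Filter.inter_mem (hC.isOpen.mem_nhds hz) hU)
    obtain ⟨C', hC', hzC', hCO⟩ := compact_exists_isClopen_in_isOpen hO hzO
    exact ⟨C', hC', hzC', hCO.trans hOs⟩
  obtain ⟨A₁, hA₁, hxA₁, hAV⟩ := hsmall hA hx hV
  have hA₁A : A₁ ⊆ A := hAV.trans inter_subset_left
  obtain ⟨B₁, hBB₁, hB₁, hyB₁, m₁, hm₁⟩ :=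
    exists_isDisplacementEquiv_diff hd hA hA₁ hB hA₁A ⟨x, hxA₁⟩ hy hAB
  have hn₁ := hm₁.sub_mem_nullFunctions_of_diff hA₁A hBB₁ hAB
  obtain ⟨B₂, hB₂, hyB₂, hBW⟩ := hsmall hB₁ hyB₁ hW
  have hB₂B : B₂ ⊆ B₁ := hBW.trans inter_subset_left
  have hn₁' : B₁.indicator 1 - A₁.indicator 1 ∈ nullFunctions d Z := by
    rw [← neg_sub]
    exact (nullFunctions d Z).neg_mem hn₁
  obtain ⟨A₂, hAA₂, hA₂, hxA₂, m₂, hm₂⟩ :=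
    exists_isDisplacementEquiv_diff hd hB₁ hB₂ hA₁ hB₂B ⟨y, hyB₂⟩ hxA₁ hn₁'
  obtain ⟨m₂', hm₂'⟩ := hm₂.exists_symm (hB₁.diff hB₂) (hA₁.diff hA₂)
  have hn₂ := hm₂'.sub_mem_nullFunctions_of_diff hAA₂ hB₂B hn₁
  obtain ⟨m, hm⟩ := hm₁.exists_union hm₂' (hA.diff hA₁)
    (disjoint_sdiff_left.mono_right sdiff_subset) (disjoint_sdiff_left.mono_right sdiff_subset)
  rw [sdiff_union_sdiff_cancel hA₁A hAA₂, sdiff_union_sdiff_cancel hBB₁ hB₂B] at hm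
  exact ⟨A₂, B₂, hA₂, hB₂, hxA₂, hyB₂, hAA₂.trans hAV,
    fun z hz => ⟨hBB₁ (hB₂B hz), (hBW hz).2⟩, hn₂, m, hm⟩

end ClopenEquiv

/-! ### Passage to the limit: gluing the shells. -/

section Limit

theorem exists_mem_sdiff_succ {W : Type*} {A : ℕ → Set W} {z : W} (h0 : z ∈ A 0) (h : ∃ n, z ∉ A (n + 1)) :
    ∃ n, z ∈ A n \ A (n + 1) := by
  classical
  refine ⟨Nat.find h, ?_, Nat.find_spec h⟩
  cases hk : Nat.find h with
  | zero => exact h0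
  | succ k =>
    by_contra hz
    exact Nat.find_min h (show k < Nat.find h by omega) hz

theorem eq_of_mem_sdiff_succ {W : Type*} {A : ℕ → Set W} (hA : Antitone A) {z : W} {i j : ℕ}
    (hi : z ∈ A i \ A (i + 1)) (hj : z ∈ A j \ A (j + 1)) : i = j := by
  rcases lt_trichotomy i j with h | h | h
  · exact absurd (hA h hj.1) hi.2
  · exact h
  · exact absurd (hA h hi.1) hj.2

variable {d : ℕ} {Z : Type*} [TopologicalSpace Z] [AddAction (Fin d → ℤ) Z]

/-- Gluing displacement equivalences between the shells of two decreasing sequences of clopen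
neighbourhoods of `x` and of `y = u +ᵥ x`. -/
theorem exists_displacement_limit [T2Space Z] [ContinuousConstVAdd (Fin d → ℤ) Z]
    {A B : ℕ → Set Z} {x y : Z} {u : Fin d → ℤ}
    {m : ℕ → Z → (Fin d → ℤ)} (hu : u +ᵥ x = y) (hA : Antitone A) (hB : Antitone B)
    (hAc : ∀ n, IsClopen (A n)) (hx : ∀ n, x ∈ A n) (hy : ∀ n, y ∈ B n)
    (hAx : ∀ U ∈ 𝓝 x, ∃ n, A n ⊆ U) (hBy : ∀ U ∈ 𝓝 y, ∃ n, B n ⊆ U)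
    (hm : ∀ n, IsDisplacementEquiv (A n \ A (n + 1)) (B n \ B (n + 1)) (m n)) :
    ∃ c : Z → (Fin d → ℤ), BijOn (fun z => c z +ᵥ z) (A 0) (B 0) ∧
      ContinuousOn (fun z => c z +ᵥ z) (A 0) ∧ ∀ z ∈ A 0, z ≠ x → ∀ᶠ z' in 𝓝 z, c z' = c z := by
  classical
  have hsep : ∀ {C : ℕ → Set Z} {w : Z}, Antitone C → (∀ U ∈ 𝓝 w, ∃ n, C n ⊆ U) →
      ∀ z ∈ C 0, z ≠ w → ∃ n, z ∈ C n \ C (n + 1) := by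
    intro C w hC hCw z hz hzw
    refine exists_mem_sdiff_succ hz ?_
    obtain ⟨n, hn⟩ := hCw {z}ᶜ (isOpen_compl_singleton.mem_nhds fun h => hzw h.symm)
    exact ⟨n, fun h => hn (hC (Nat.le_succ n) h) rfl⟩
  -- The value u matters at x, the one point of A 0 in no shell; off A 0 it is an arbitrary default.
  let c : Z → (Fin d → ℤ) := fun z =>
    if h : ∃ n, z ∈ A n \ A (n + 1) then m h.choose z else u
  have hc : ∀ n, ∀ z ∈ A n \ A (n + 1), c z = m n z := by
    intro n z hz
    have h : ∃ n, z ∈ A n \ A (n + 1) := ⟨n, hz⟩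
    simp only [c, dif_pos h]
    rw [eq_of_mem_sdiff_succ hA h.choose_spec hz]
  have hcx : c x = u := dif_neg fun ⟨n, hn⟩ => hn.2 (hx _)
  have hmap : ∀ n, ∀ z ∈ A n \ A (n + 1), c z +ᵥ z ∈ B n \ B (n + 1) := by
    intro n z hz
    rw [hc n z hz]
    exact (hm n).bijOn.mapsTo hz
  have hev : ∀ n, ∀ z ∈ A n \ A (n + 1), ∀ᶠ z' in 𝓝 z, c z' = c z := by
    intro n z hz
    filter_upwards [((hAc n).diff (hAc (n + 1))).isOpen.mem_nhds hz,
      (hm n).continuous.eventually_eq_of_discrete z] with z' hz' hmz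
    rw [hc n z' hz', hc n z hz, hmz]
  refine ⟨c, ⟨fun z hz => ?_, fun z hz z' hz' heq => ?_, fun w hw => ?_⟩, fun z hz => ?_,
    fun z hz hzx => ?_⟩
  · by_cases hzx : z = x
    · subst hzx
      simp only [hcx, hu]
      exact hy 0
    · obtain ⟨n, hn⟩ := hsep hA hAx z hz hzx
      exact hB (Nat.zero_le n) (hmap n z hn).1
  · simp only at heq
    by_cases hzx : z = x <;> by_cases hzx' : z' = x
    · rw [hzx, hzx']
    · obtain ⟨n, hn⟩ := hsep hA hAx z' hz' hzx'
      rw [hzx, hcx, hu] at heq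
      exact absurd (hy _) (heq ▸ (hmap n z' hn).2)
    · obtain ⟨n, hn⟩ := hsep hA hAx z hz hzx
      rw [hzx', hcx, hu] at heq
      exact absurd (hy _) (heq ▸ (hmap n z hn).2)
    · obtain ⟨n, hn⟩ := hsep hA hAx z hz hzx
      obtain ⟨n', hn'⟩ := hsep hA hAx z' hz' hzx'
      obtain rfl := eq_of_mem_sdiff_succ hB (hmap n z hn) (heq ▸ hmap n' z' hn')
      rw [hc n z hn, hc n z' hn'] at heq
      exact (hm n).bijOn.injOn hn hn' heq
  · by_cases hwy : w = y
    · exact ⟨x, hx 0, by simp only [hcx, hu, hwy]⟩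
    · obtain ⟨n, hn⟩ := hsep hB hBy w hw hwy
      obtain ⟨z, hz, rfl⟩ := (hm n).bijOn.surjOn hn
      exact ⟨z, hA (Nat.zero_le n) hz.1, by simp only [hc n z hz]⟩
  · by_cases hzx : z = x
    · subst hzx
      refine ContinuousAt.continuousWithinAt ?_
      intro U hU
      simp only [hcx, hu] at hU
      -- The map sends A n into B n, and the B n shrink to y. This gives continuity of the map at x
      -- although the displacement may be unbounded there.
      obtain ⟨n, hn⟩ := hBy U hU
      refine Filter.mem_map.2 (Filter.mem_of_superset ((hAc n).isOpen.mem_nhds (hx n))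
        fun z' hz' => hn ?_)
      by_cases hzz : z' = z
      · subst hzz
        simp only [hcx, hu]
        exact hy n
      · obtain ⟨j, hj⟩ := hsep hA hAx z' (hA (Nat.zero_le n) hz') hzz
        have hnj : n ≤ j := by
          by_contra hlt
          exact hj.2 (hA (by omega) hz')
        exact hB hnj (hmap j z' hj).1
    · obtain ⟨n, hn⟩ := hsep hA hAx z hz hzx
      exact (continuousAt_displacement (hev n z hn)).continuousWithinAt
  · obtain ⟨n, hn⟩ := hsep hA hAx z hz hzx
    exact hev n z hn

variable [CantorSpace Z] [MinimalFreeSystem d Z]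

/-- If `1_A - 1_B` is null, then `A` and `B` are homeomorphic by a map preserving orbits, whose
displacement is continuous except at one prescribed point. -/
theorem exists_displacement_bijOn (hd : 0 < d) {A B : Set Z} (hA : IsClopen A)
    (hB : IsClopen B) {x : Z} (hx : x ∈ A) (hne : B.Nonempty)
    (hAB : A.indicator 1 - B.indicator 1 ∈ nullFunctions d Z) :
    ∃ c : Z → (Fin d → ℤ), BijOn (fun z => c z +ᵥ z) A B ∧
      ContinuousOn (fun z => c z +ᵥ z) A ∧ ∀ z ∈ A, z ≠ x → ∀ᶠ z' in 𝓝 z, c z' = c z := by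
  -- Density of the orbit of x supplies a target in B within that orbit, so the map respects orbits
  -- at the exceptional point too.
  obtain ⟨u, hu⟩ := hB.isOpen.exists_vadd_mem (Fin d → ℤ) x hne
  obtain ⟨V, hV⟩ := (𝓝 x).exists_antitone_basis
  obtain ⟨W, hW⟩ := (𝓝 (u +ᵥ x)).exists_antitone_basis
  let State := {p : Set Z × Set Z // IsClopen p.1 ∧ IsClopen p.2 ∧ x ∈ p.1 ∧ u +ᵥ x ∈ p.2 ∧
    p.1.indicator 1 - p.2.indicator 1 ∈ nullFunctions d Z}
  have hstep : ∀ (n : ℕ) (p : State), ∃ q : State, q.1.1 ⊆ p.1.1 ∩ V n ∧ q.1.2 ⊆ p.1.2 ∩ W n ∧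
      ∃ m : Z → (Fin d → ℤ), IsDisplacementEquiv (p.1.1 \ q.1.1) (p.1.2 \ q.1.2) m := by
    rintro n ⟨⟨A, B⟩, hA, hB, hxA, hyB, hAB⟩
    obtain ⟨A', B', hA', hB', hxA', hyB', hAA, hBB, hAB', m, hm⟩ :=
      exists_isDisplacementEquiv_step hd hA hB hxA hyB hAB (hV.1.mem_of_mem trivial)
        (hW.1.mem_of_mem trivial)
    exact ⟨⟨(A', B'), hA', hB', hxA', hyB', hAB'⟩, hAA, hBB, m, hm⟩
  choose next hnextA hnextB m hm using hstep
  let s : ℕ → State := fun n => Nat.rec ⟨(A, B), hA, hB, hx, hu, hAB⟩ (fun n p => next n p) n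
  have hs : ∀ n, s (n + 1) = next n (s n) := fun n => rfl
  refine exists_displacement_limit (A := fun n => (s n).1.1) (B := fun n => (s n).1.2)
    (m := fun n => m n (s n)) (u := u) (x := x) rfl
    (antitone_nat_of_succ_le fun n => (hnextA n (s n)).trans inter_subset_left)
    (antitone_nat_of_succ_le fun n => (hnextB n (s n)).trans inter_subset_left)
    (fun n => (s n).2.1) (fun n => (s n).2.2.2.1) (fun n => (s n).2.2.2.2.1) ?_ ?_
    (fun n => hm n (s n))
  · intro U hU
    obtain ⟨n, -, hn⟩ := hV.1.mem_iff.1 hU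
    exact ⟨n + 1, ((hnextA n (s n)).trans inter_subset_right).trans hn⟩
  · intro U hU
    obtain ⟨n, -, hn⟩ := hW.1.mem_iff.1 hU
    exact ⟨n + 1, ((hnextB n (s n)).trans inter_subset_right).trans hn⟩

end Limit

/-! ### Transfer to X and Y: the main theorem. -/

theorem extendByZero_one {d : ℕ} {X Z : Type*} [TopologicalSpace X] [AddAction (Fin d → ℤ) X]
    [TopologicalSpace Z] [AddAction (Fin d → ℤ) Z] [CompactSpace X] [T2Space Z] {θ : X → Z}
    (hθ : IsOrbitInjection d θ) (z : Z) :
    (extendByZero d hθ 1 z : ℝ) = (range θ).indicator 1 z := by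
  by_cases hz : z ∈ range θ
  · rw [indicator_of_mem hz]
    obtain ⟨x, rfl⟩ := hz
    rw [extendByZero_apply]
    simp
  · rw [indicator_of_notMem hz, extendByZero_apply_of_notMem d hθ _ hz, Int.cast_zero]

theorem IsOrbitInjection.isClopen_range {d : ℕ} {X Z : Type*} [TopologicalSpace X]
    [AddAction (Fin d → ℤ) X] [TopologicalSpace Z] [AddAction (Fin d → ℤ) Z] [CompactSpace X]
    [T2Space Z] {θ : X → Z} (hθ : IsOrbitInjection d θ) : IsClopen (range θ) :=
  ⟨(isCompact_range hθ.continuous).isClosed, hθ.isOpenMap.isOpen_range⟩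

theorem mainTheorem6 {d : ℕ} (hd : 0 < d) {X Y Z : Type*}
    [TopologicalSpace X] [CantorSpace X] [AddAction (Fin d → ℤ) X] [MinimalFreeSystem d X]
    [TopologicalSpace Y] [CantorSpace Y] [AddAction (Fin d → ℤ) Y] [MinimalFreeSystem d Y]
    [TopologicalSpace Z] [CantorSpace Z] [AddAction (Fin d → ℤ) Z] [MinimalFreeSystem d Z]
    (θ₁ : X → Z) (h₁ : IsBoundedOrbitInjection d θ₁)
    (θ₂ : Y → Z) (h₂ : IsBoundedOrbitInjection d θ₂)
    (hinf : inducedHom d h₁ (cohomClass d X 1) - inducedHom d h₂ (cohomClass d Y 1) ∈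
      infinitesimals (positiveCone d Z))
    (x₀ : X) :
    ∃ θ : X ≃ₜ Y, IsOrbitEquivalence d θ ∧
      ∃ η : X × (Fin d → ℤ) → (Fin d → ℤ),
        (∀ (x y : X) (w : Fin d → ℤ), w +ᵥ x = y ↔ η (x, w) +ᵥ θ x = θ y) ∧
        ∀ w : Fin d → ℤ, ContinuousOn (fun x => η (x, w)) {x₀, (-w) +ᵥ x₀}ᶜ := by
  have : Nonempty Z := ⟨θ₁ x₀⟩
  have : Nonempty Y := CantorSpace.nonempty
  have hnull : (range θ₁).indicator 1 - (range θ₂).indicator 1 ∈ nullFunctions d Z := by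
    rw [inducedHom_cohomClass, inducedHom_cohomClass, ← map_sub] at hinf
    convert mem_nullFunctions_of_mem_infinitesimals hinf using 1
    ext z
    rw [ContinuousMap.sub_apply, Int.cast_sub, extendByZero_one, extendByZero_one]
    rfl
  obtain ⟨c, hbij, hcont, hev⟩ := exists_displacement_bijOn hd h₁.toIsOrbitInjection.isClopen_range
    h₂.toIsOrbitInjection.isClopen_range (mem_range_self x₀) (range_nonempty θ₂) hnull
  -- The orbit equivalence is θ₂⁻¹ ∘ (z ↦ c(z) + z) ∘ θ₁.
  have hex : ∀ x, ∃ y, θ₂ y = c (θ₁ x) +ᵥ θ₁ x := fun x => hbij.mapsTo (mem_range_self x)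
  choose f hf using hex
  have hfbij : Function.Bijective f := by
    constructor
    · intro x x' hxx
      refine h₁.injective (hbij.injOn (mem_range_self x) (mem_range_self x') ?_)
      rw [← hf, ← hf, hxx]
    · intro y
      obtain ⟨_, ⟨x, rfl⟩, hx⟩ := hbij.surjOn (mem_range_self y)
      exact ⟨x, h₂.injective ((hf x).trans hx)⟩
  have hemb₂ : IsOpenEmbedding θ₂ :=
    IsOpenEmbedding.of_continuous_injective_isOpenMap h₂.continuous h₂.injective h₂.isOpenMap
  have hfcont : Continuous f := by
    rw [hemb₂.isEmbedding.continuous_iff, show θ₂ ∘ f = fun x => c (θ₁ x) +ᵥ θ₁ x from funext hf]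
    exact hcont.comp_continuous h₁.continuous mem_range_self
  let θ : X ≃ₜ Y := Continuous.homeoOfEquivCompactToT2 (f := Equiv.ofBijective f hfbij) hfcont
  have hθ : ∀ x, θ₂ (θ x) = c (θ₁ x) +ᵥ θ₁ x := hf
  have horb : ∀ x x' : X, (∃ w : Fin d → ℤ, w +ᵥ x = x') ↔ ∃ v : Fin d → ℤ, v +ᵥ θ x = θ x' := by
    intro x x'
    rw [h₁.orbit_iff, h₂.orbit_iff, hθ, hθ]
    constructor
    · rintro ⟨v, hv⟩
      refine ⟨c (θ₁ x') + v + -c (θ₁ x), ?_⟩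
      rw [add_vadd, neg_vadd_vadd, add_vadd, hv]
    · rintro ⟨v, hv⟩
      refine ⟨-c (θ₁ x') + v + c (θ₁ x), ?_⟩
      rw [add_vadd, add_vadd, hv, neg_vadd_vadd]
  have hcoc : ∀ p : X × (Fin d → ℤ), ∃ v : Fin d → ℤ, v +ᵥ θ p.1 = θ (p.2 +ᵥ p.1) := fun p =>
    (horb _ _).1 ⟨p.2, rfl⟩
  choose η hη using hcoc
  refine ⟨θ, fun x => ?_, η, fun x y w => ?_, fun w x hx => ?_⟩
  · ext y
    constructor
    · rintro ⟨x', ⟨w, rfl⟩, rfl⟩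
      exact (horb _ _).1 ⟨w, rfl⟩
    · rintro ⟨v, hv⟩
      obtain ⟨x', rfl⟩ := θ.surjective y
      obtain ⟨w, rfl⟩ := (horb x x').2 ⟨v, hv⟩
      exact ⟨_, ⟨w, rfl⟩, rfl⟩
  · rw [hη (x, w), θ.injective.eq_iff]
  · simp only [mem_compl_iff, mem_insert_iff, mem_singleton_iff, not_or] at hx
    have hx₂ : w +ᵥ x ≠ x₀ := fun h => hx.2 (by rw [← h, neg_vadd_vadd])
    obtain ⟨η₁, hη₁, hη₁c⟩ := h₁.exists_continuous_cocycle
    obtain ⟨η₂, hη₂, hη₂c⟩ := h₂.exists_continuous_cocycle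
    have hne : ∀ x, x ≠ x₀ → ∀ᶠ x' in 𝓝 x, c (θ₁ x') = c (θ₁ x) := fun x hx =>
      h₁.continuous.continuousAt.eventually
        (hev _ (mem_range_self x) fun h => hx (h₁.injective h))
    have e1 := hne x hx.1
    have e2 : ∀ᶠ x' in 𝓝 x, c (θ₁ (w +ᵥ x')) = c (θ₁ (w +ᵥ x)) :=
      (continuous_const_vadd w).continuousAt.eventually (hne _ hx₂)
    have e3 : ∀ᶠ x' in 𝓝 x, η₁ (x', w) = η₁ (x, w) :=
      (hη₁c.comp (Continuous.prodMk_left w)).eventually_eq_of_discrete x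
    have e4 : ∀ᶠ x' in 𝓝 x, η₂ (θ x', η (x, w)) = η₂ (θ x, η (x, w)) :=
      ((hη₂c.comp (Continuous.prodMk_left (η (x, w)))).comp
        θ.continuous).eventually_eq_of_discrete x
    -- The displacement in Z from θ₂(θ x') to θ₂(θ(w + x')) is locally constant in x' away from x₀
    -- and -w + x₀, since c fails to be so at most at θ₁(x₀).
    have key : ∀ x', θ₂ (θ (w +ᵥ x')) =
        (c (θ₁ (w +ᵥ x')) + η₁ (x', w) + -c (θ₁ x')) +ᵥ θ₂ (θ x') := by
      intro x'
      rw [hθ, hθ, add_vadd, neg_vadd_vadd, add_vadd, hη₁]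
    refine ContinuousAt.continuousWithinAt (continuousAt_const.congr (f := fun _ => η (x, w)) ?_)
    filter_upwards [e1, e2, e3, e4] with x' h1 h2 h3 h4
    have h5 : η₂ (θ x, η (x, w)) = c (θ₁ (w +ᵥ x)) + η₁ (x, w) + -c (θ₁ x) :=
      vadd_left_cancel_of_free (z := θ₂ (θ x)) (by rw [hη₂, hη (x, w), key])
    -- Near x the fixed vector η(x, w) produces, through η₂, the same displacement in Z as the one
    -- required at x'. Injectivity of θ₂ and freeness then force η(x', w) = η(x, w).
    have h6 : η (x, w) +ᵥ θ x' = θ (w +ᵥ x') := by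
      apply h₂.injective
      rw [← hη₂, h4, h5, key, h1, h2, h3]
    exact vadd_left_cancel_of_free (h6.trans (hη (x', w)).symm)
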